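/- **Proposition 2.1.** Let $0<\alpha\le 1$ and $k\ge 0$. For $m=0,1,2,\dots$ let $J_m(t)=\left(\frac t2\right)^m\sum_{n=0}^\infty\frac{(-1)^n}{(m+n)!\,n!}\left(\frac t2\right)^{2n}$ be the Bessel function of order $m$, and let $\hat J_m(t)=\left(\frac 2t\right)^m m!\,J_m(t)$ for $t\ne0$, $\hat J_m(0)=1$. For $x=(x_1,x_2)\in\mathbb R^2$ and $\tau>0$ put $$E^k_\alpha(x;\tau)=\sum_{m=0}^\infty\frac{\{\tau(x_1+ix_2)\}^m}{\Gamma(\alpha m+1)}\,\hat J_m(k|x|),$$ which is the Vekua transform of the Mittag-Leffler function $E_\alpha(\tau(x_1+ix_2))=\sum_{m\ge0}\{\tau(x_1+ix_2)\}^m/\Gamma(\alpha m+1)$. For an angle $\theta$ let $C(\theta)=\{x\in\mathbb R^2 : x_1>|x|\cos\theta\}$. The value $1/\Gamma(0)$ is read as $0$. Let $x\in\mathbb R^2\setminus\overline{C(\pi\alpha/2)}$. Then $E^k_\alpha(\,\cdot\,;\tau)$ (for every $\tau>0$) and the function $\left(\frac{k|x|}2\right)^2\frac{\hat J_1(k|x|)}{x_1+ix_2}$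 are differentiable at $x$, and, as $\tau\to\infty$, $$E^k_\alpha(x;\tau)=\left(\frac{k|x|}{2}\right)^2\frac{\hat J_1(k|x|)}{x_1+ix_2}\,\frac1{\Gamma(1-\alpha)}\,\frac{\log\tau}{\tau}+O\left(\frac1\tau\right)$$ and, for $j=1,2$, $$\frac{\partial}{\partial x_j}E^k_\alpha(x;\tau)=\frac{\partial}{\partial x_j}\left\{\left(\frac{k|x|}{2}\right)^2\frac{\hat J_1(k|x|)}{x_1+ix_2}\right\}\frac1{\Gamma(1-\alpha)}\,\frac{\log\tau}{\tau}+O\left(\frac1\tau\right).$$ In particular, $E^k_\alpha(x;\tau)\to0$ as $\tau\to\infty$. Both asymptotics are uniform in the following sense: for all $\epsilon$ with $0<\epsilon<\pi-\pi\alpha/2$ and all $R>0$ there are constants $C$ and $\tau_0>0$ such that, for all $\tau\ge\tau_0$ and all $x\in\mathbb R^2\setminus\overline{C(\pi\alpha/2+\epsilon)}$ with $R^{-1}<|x|<R$, the differences of the two sides without the terms $O(1/\tau)$ are bounded in absolute value by $C/\tau$. -/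

import Mathlib

open Filter Asymptotics

/-- The Euclidean plane `ℝ²`; the coordinates `x₁, x₂` are `x 0, x 1`. -/
abbrev Plane : Type := EuclideanSpace ℝ (Fin 2)

/-- The complex number `x₁ + i x₂`. -/
noncomputable def toComplex (x : Plane) : ℂ := (x 0 : ℂ) + Complex.I * (x 1 : ℂ)

/-- The Bessel function `J_m` of order `m = 0, 1, …`, by its power series. -/
noncomputable def besselJ (m : ℕ) (t : ℝ) : ℝ :=
  (t / 2) ^ m *
    ∑' n : ℕ, (-1 : ℝ) ^ n / ((Nat.factorial (m + n) : ℝ) * (Nat.factorial n : ℝ)) *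
      (t / 2) ^ (2 * n)

/-- The normalized Bessel function `Ĵ_m(t) = (2/t)^m m! J_m(t)`, with its removable singularity
at `t = 0` filled in by the limit value `1`. -/
noncomputable def besselJHat (m : ℕ) (t : ℝ) : ℝ :=
  if t = 0 then 1 else (2 / t) ^ m * (Nat.factorial m : ℝ) * besselJ m t

/-- The power series of `Ĵ_m`, valid for every real `t`, including `t = 0`. -/
theorem besselJHat_eq_tsum (m : ℕ) (t : ℝ) :
    besselJHat m t = (Nat.factorial m : ℝ) *
      ∑' n : ℕ, (-1 : ℝ) ^ n / ((Nat.factorial (m + n) : ℝ) * (Nat.factorial n : ℝ)) *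
        (t / 2) ^ (2 * n) := by
  unfold besselJHat besselJ
  split_ifs with h
  · subst h
    rw [tsum_eq_single 0]
    · simp [Nat.factorial_ne_zero]
    · intro n hn
      simp [hn]
  · have h1 : (2 / t) ^ m * (t / 2) ^ m = 1 := by
      rw [← mul_pow]
      field_simp
      simp
    rw [mul_assoc, mul_left_comm, ← mul_assoc ((2 / t) ^ m), h1, one_mul]

/-- The modified Mittag-Leffler function
`E^k_α(x;τ) = ∑ₘ {τ(x₁+ix₂)}^m / Γ(αm+1) · Ĵ_m(k|x|)`. For `k|x| ≠ 0` the factor `Ĵ_m(k|x|)` is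
`(2/(k|x|))^m m! J_m(k|x|)`; for `k|x| = 0` it is `1`, so that `E^0_α(x;τ)` is the Mittag-Leffler
function at `τ(x₁+ix₂)` and `E^k_α(0;τ) = 1`. -/
noncomputable def mittagLefflerVekua (α k : ℝ) (x : Plane) (τ : ℝ) : ℂ :=
  ∑' m : ℕ, ((τ : ℂ) * toComplex x) ^ m / ((Real.Gamma (α * m + 1) : ℝ) : ℂ) *
    ((besselJHat m (k * ‖x‖) : ℝ) : ℂ)

/-- The factor `(k|x|/2)² Ĵ₁(k|x|) / (x₁+ix₂)`. -/
noncomputable def besselFactor (k : ℝ) (x : Plane) : ℂ :=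
  (((k * ‖x‖ / 2) ^ 2 : ℝ) : ℂ) * (((besselJHat 1 (k * ‖x‖) : ℝ) : ℂ) / toComplex x)

/-- The open cone `C_y(ω, θ)` about the direction `ω` with vertex `y` and half-angle `θ`. -/
def openCone (y ω : Plane) (θ : ℝ) : Set Plane :=
  {x | ‖x - y‖ * Real.cos θ < inner ℝ (x - y) ω}

/-- The cone `C(θ) = C_0((1,0), θ)`. -/
noncomputable def cone (θ : ℝ) : Set Plane := openCone 0 (EuclideanSpace.single 0 1) θ

/-- The partial derivative `∂f/∂x_j` (used together with differentiability of `f` at `x`). -/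
noncomputable def partialDeriv (j : Fin 2) (f : Plane → ℂ) (x : Plane) : ℂ :=
  fderiv ℝ f x (EuclideanSpace.single j 1)

open MeasureTheory Set in
theorem rpow_mul_exp_neg_le_Gamma {y T : ℝ} (hy : 0 ≤ y) (hT : 0 < T) :
    T ^ y * Real.exp (-T) ≤ Real.Gamma (y + 1) := by
  rw [Real.Gamma_eq_integral (by linarith)]
  have hint := Real.GammaIntegral_convergent (s := y + 1) (by linarith)
  have hsub : Ioi T ⊆ Ioi (0 : ℝ) := Ioi_subset_Ioi hT.le
  calc T ^ y * Real.exp (-T) = ∫ x in Ioi T, T ^ y * Real.exp (-x) := by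
        rw [integral_const_mul, integral_exp_neg_Ioi]
    _ ≤ ∫ x in Ioi T, Real.exp (-x) * x ^ (y + 1 - 1) := by
        refine setIntegral_mono_on ((integrableOn_exp_neg_Ioi T).const_mul _)
          (hint.mono_set hsub) measurableSet_Ioi fun x hx => ?_
        rw [add_sub_cancel_right, mul_comm]
        gcongr
        exact (mem_Ioi.1 hx).le
    _ ≤ ∫ x in Ioi 0, Real.exp (-x) * x ^ (y + 1 - 1) := by
        refine setIntegral_mono_set hint ?_ hsub.eventuallyLE
        filter_upwards [ae_restrict_mem measurableSet_Ioi] with x hx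
        have := mem_Ioi.1 hx
        positivity

theorem Gamma_mul_add_one_pos {α : ℝ} (hα : 0 < α) (m : ℕ) : 0 < Real.Gamma (α * m + 1) :=
  Real.Gamma_pos_of_pos (by positivity)

theorem summable_pow_div_Gamma {α : ℝ} (hα : 0 < α) {R : ℝ} (hR : 0 ≤ R) :
    Summable fun m : ℕ => R ^ m / Real.Gamma (α * m + 1) := by
  set T : ℝ := (2 * R + 1) ^ α⁻¹ with hTdef
  have hT : 0 < T := by positivity
  have hTα : T ^ α = 2 * R + 1 := by
    rw [hTdef, ← Real.rpow_mul (by positivity), inv_mul_cancel₀ hα.ne', Real.rpow_one]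
  have hq : R / (2 * R + 1) < 1 := by
    rw [div_lt_one (by positivity)]; linarith
  refine Summable.of_nonneg_of_le (fun m => ?_) (fun m => ?_)
    ((summable_geometric_of_lt_one (by positivity) hq).mul_left (Real.exp T))
  · have := Gamma_mul_add_one_pos hα m
    positivity
  · have h := rpow_mul_exp_neg_le_Gamma (y := α * m) (by positivity) hT
    rw [Real.rpow_mul hT.le, hTα, Real.rpow_natCast, Real.exp_neg] at h
    rw [div_pow, div_le_iff₀ (Gamma_mul_add_one_pos hα m)]
    calc R ^ m = Real.exp T * (R ^ m / (2 * R + 1) ^ m) *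
          ((2 * R + 1) ^ m * (Real.exp T)⁻¹) := by
          field_simp
      _ ≤ _ := by gcongr

/-- The Mittag-Leffler function. -/
noncomputable def mittagLeffler (α : ℝ) (w : ℂ) : ℂ :=
  ∑' m : ℕ, w ^ m / ((Real.Gamma (α * m + 1) : ℝ) : ℂ)

/-- The entire function `B_m` with `Ĵ_m(t) = B_m((t/2)²)`. -/
noncomputable def besselEntire (m : ℕ) (q : ℂ) : ℂ :=
  ∑' n : ℕ, (-q) ^ n * ((m.factorial : ℂ) / (((m + n).factorial : ℂ) * (n.factorial : ℂ)))

/-- The Vekua transform of the Mittag-Leffler function, as a function of two complex variables. -/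
noncomputable def vekuaSeries (α : ℝ) (p : ℂ × ℂ) : ℂ :=
  ∑' m : ℕ, p.1 ^ m / ((Real.Gamma (α * m + 1) : ℝ) : ℂ) * besselEntire m p.2

theorem norm_pow_div_Gamma {α : ℝ} (hα : 0 < α) (w : ℂ) (m : ℕ) :
    ‖w ^ m / ((Real.Gamma (α * m + 1) : ℝ) : ℂ)‖ = ‖w‖ ^ m / Real.Gamma (α * m + 1) := by
  rw [norm_div, norm_pow, Complex.norm_real, Real.norm_of_nonneg (Gamma_mul_add_one_pos hα m).le]

theorem norm_besselEntire_term_le (m n : ℕ) (q : ℂ) :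
    ‖(-q) ^ n * ((m.factorial : ℂ) / (((m + n).factorial : ℂ) * (n.factorial : ℂ)))‖ ≤
      ‖q‖ ^ n / n.factorial := by
  rw [norm_mul, norm_pow, norm_neg, norm_div, norm_mul, Complex.norm_natCast,
    Complex.norm_natCast, Complex.norm_natCast, ← div_div, div_eq_mul_one_div (‖q‖ ^ n)]
  gcongr
  rw [div_le_one (by positivity)]
  exact_mod_cast Nat.factorial_le (Nat.le_add_right m n)

theorem summable_besselEntire (m : ℕ) (q : ℂ) :
    Summable fun n : ℕ =>
      (-q) ^ n * ((m.factorial : ℂ) / (((m + n).factorial : ℂ) * (n.factorial : ℂ))) :=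
  .of_norm_bounded (Real.summable_pow_div_factorial ‖q‖) fun n => norm_besselEntire_term_le m n q

theorem norm_besselEntire_le (m : ℕ) (q : ℂ) : ‖besselEntire m q‖ ≤ Real.exp ‖q‖ := by
  rw [Real.exp_eq_exp_ℝ]
  exact tsum_of_norm_bounded (NormedSpace.expSeries_div_hasSum_exp (𝔸 := ℝ) ‖q‖)
    fun n => norm_besselEntire_term_le m n q

theorem differentiable_tsum_of_summable_norm_on_balls {E : Type*} [NormedAddCommGroup E]
    [NormedSpace ℂ E] {F : ℕ → E → ℂ} (hF : ∀ n, Differentiable ℂ (F n))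
    (hb : ∀ R : ℝ, 0 < R → ∃ u : ℕ → ℝ, Summable u ∧ ∀ n x, ‖x‖ ≤ R → ‖F n x‖ ≤ u n) :
    Differentiable ℂ fun x => ∑' n, F n x := by
  intro x
  have hR : 0 < ‖x‖ + 1 := by positivity
  obtain ⟨u, hu, hle⟩ := hb (‖x‖ + 1 + 1) (by positivity)
  refine (hasFDerivAt_tsum_of_isPreconnected (𝕜 := ℂ) (s := Metric.ball (0 : E) (‖x‖ + 1))
    (x₀ := 0) (f' := fun n y => fderiv ℂ (F n) y) (hu.mul_left 2) Metric.isOpen_ball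
    (convex_ball _ _).isPreconnected (fun n y _ => (hF n y).hasFDerivAt) (fun n y hy => ?_)
    (Metric.mem_ball_self hR) ?_ (by simp)).differentiableAt
  · rw [mem_ball_zero_iff] at hy
    rw [← div_one (2 * u n)]
    refine Complex.norm_fderiv_le_div_of_mapsTo_ball (hF n).differentiableOn
      (fun v hv => ?_) one_pos
    rw [mem_ball_iff_norm] at hv
    rw [mem_closedBall_iff_norm, two_mul]
    have hv' : ‖v‖ ≤ ‖x‖ + 1 + 1 := by
      have := norm_add_le y (v - y)
      rw [add_sub_cancel] at this
      linarith
    exact (norm_sub_le _ _).trans (add_le_add (hle n v hv') (hle n y (by linarith)))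
  · exact .of_norm_bounded hu fun n => hle n 0 (by simpa using by positivity)

theorem differentiable_besselEntire (m : ℕ) : Differentiable ℂ (besselEntire m) := by
  refine differentiable_tsum_of_summable_norm_on_balls (fun n => by fun_prop) fun R hR =>
    ⟨_, Real.summable_pow_div_factorial R, fun n q hq => ?_⟩
  refine (norm_besselEntire_term_le m n q).trans ?_
  gcongr

theorem norm_vekuaSeries_term_le {α : ℝ} (hα : 0 < α) (m : ℕ) (w q : ℂ) :
    ‖w ^ m / ((Real.Gamma (α * m + 1) : ℝ) : ℂ) * besselEntire m q‖ ≤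
      ‖w‖ ^ m / Real.Gamma (α * m + 1) * Real.exp ‖q‖ := by
  rw [norm_mul, norm_pow_div_Gamma hα]
  have := Gamma_mul_add_one_pos hα m
  gcongr
  exact norm_besselEntire_le m q

theorem differentiable_vekuaSeries {α : ℝ} (hα : 0 < α) : Differentiable ℂ (vekuaSeries α) := by
  refine differentiable_tsum_of_summable_norm_on_balls (fun m => ?_) fun R hR =>
    ⟨_, (summable_pow_div_Gamma hα hR.le).mul_right (Real.exp R), fun m p hp => ?_⟩
  · have h : Differentiable ℂ fun p : ℂ × ℂ =>
        p.1 ^ m / ((Real.Gamma (α * m + 1) : ℝ) : ℂ) := by fun_prop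
    exact h.mul ((differentiable_besselEntire m).comp differentiable_snd)
  · refine (norm_vekuaSeries_term_le hα m p.1 p.2).trans ?_
    have := Gamma_mul_add_one_pos hα m
    have h1 := (norm_fst_le p).trans hp
    have h2 := (norm_snd_le p).trans hp
    gcongr

theorem summable_mittagLeffler {α : ℝ} (hα : 0 < α) (w : ℂ) :
    Summable fun m : ℕ => w ^ m / ((Real.Gamma (α * m + 1) : ℝ) : ℂ) :=
  .of_norm_bounded (summable_pow_div_Gamma hα (norm_nonneg w))
    fun m => (norm_pow_div_Gamma hα w m).le

theorem differentiable_mittagLeffler {α : ℝ} (hα : 0 < α) :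
    Differentiable ℂ (mittagLeffler α) := by
  refine differentiable_tsum_of_summable_norm_on_balls (fun m => by fun_prop) fun R hR =>
    ⟨_, summable_pow_div_Gamma hα hR.le, fun m w hw => ?_⟩
  rw [norm_pow_div_Gamma hα]
  have := Gamma_mul_add_one_pos hα m
  gcongr

theorem exists_norm_mittagLeffler_le {α : ℝ} (hα : 0 < α) (R : ℝ) :
    ∃ M : ℝ, 0 ≤ M ∧ ∀ w : ℂ, ‖w‖ ≤ R → ‖mittagLeffler α w‖ ≤ M := by
  obtain ⟨M, hM⟩ := (isCompact_closedBall (0 : ℂ) R).exists_bound_of_continuousOn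
    (differentiable_mittagLeffler hα).continuous.continuousOn
  exact ⟨max M 0, le_max_right _ _, fun w hw =>
    (hM w (by simpa using hw)).trans (le_max_left _ _)⟩

theorem ofReal_besselJHat (m : ℕ) (t : ℝ) :
    ((besselJHat m t : ℝ) : ℂ) = besselEntire m (((t / 2) ^ 2 : ℝ) : ℂ) := by
  rw [besselJHat_eq_tsum, besselEntire, Complex.ofReal_mul, Complex.ofReal_tsum, ← tsum_mul_left]
  refine tsum_congr fun n => ?_
  push_cast
  rw [neg_pow ((t / 2 : ℂ) ^ 2), pow_mul]
  ring

theorem mittagLefflerVekua_eq (α k : ℝ) (x : Plane) (τ : ℝ) :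
    mittagLefflerVekua α k x τ =
      vekuaSeries α ((τ : ℂ) * toComplex x, (((k * ‖x‖ / 2) ^ 2 : ℝ) : ℂ)) := by
  simp only [mittagLefflerVekua, vekuaSeries, ofReal_besselJHat]

theorem besselFactor_eq (k : ℝ) (x : Plane) :
    besselFactor k x = (((k * ‖x‖ / 2) ^ 2 : ℝ) : ℂ) *
      besselEntire 1 (((k * ‖x‖ / 2) ^ 2 : ℝ) : ℂ) / toComplex x := by
  rw [besselFactor, ofReal_besselJHat, ← mul_div_assoc]

/-- The integral over the Hankel contour consisting of the half-lines `Im v = ±φ`, `Re v > L` and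
the segment that joins their end points, in the logarithmic coordinate `v = log ζ`. -/
noncomputable def hankelIntegral (L φ : ℝ) (g : ℂ → ℂ) : ℂ :=
  (∫ x in Set.Ioi L, g (x + (φ : ℝ) * Complex.I)) -
    (∫ x in Set.Ioi L, g (x + ((-φ : ℝ) : ℂ) * Complex.I)) +
    Complex.I * ∫ y in (-φ)..φ, g (L + y * Complex.I)

/-- `exp(ζ) ζ^β` in the coordinate `v = log ζ`. -/
noncomputable def hankelKernel (β : ℝ) (v : ℂ) : ℂ :=
  Complex.exp (Complex.exp v) * Complex.exp (β * v)

open MeasureTheory Set in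
theorem hankelIntegral_eq_of_le {L L' φ : ℝ} (hL : L' ≤ L) (hφ : 0 ≤ φ) {g : ℂ → ℂ}
    (hg : DifferentiableOn ℂ g {v | |v.im| ≤ φ ∧ v.re ∈ Icc L' L})
    (h1 : IntegrableOn (fun x : ℝ => g (x + (φ : ℝ) * Complex.I)) (Ioi L'))
    (h2 : IntegrableOn (fun x : ℝ => g (x + ((-φ : ℝ) : ℂ) * Complex.I)) (Ioi L')) :
    hankelIntegral L φ g = hankelIntegral L' φ g := by
  have h := Complex.integral_boundary_rect_eq_zero_of_differentiableOn g ⟨L', -φ⟩ ⟨L, φ⟩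
    (hg.mono fun v hv => by
      rw [Complex.mem_reProdIm, uIcc_of_le hL, uIcc_of_le (by linarith)] at hv
      exact ⟨abs_le.2 hv.2, hv.1⟩)
  have sub {f : ℝ → ℂ} (hf : IntegrableOn f (Ioi L')) :
      (∫ x in L'..L, f x) + ∫ x in Ioi L, f x = ∫ x in Ioi L', f x := by
    refine intervalIntegral.integral_interval_add_Ioi hf (hf.mono_set (Ioi_subset_Ioi hL))
  simp only [smul_eq_mul] at h
  rw [hankelIntegral, hankelIntegral, ← sub h1, ← sub h2]
  linear_combination h

open MeasureTheory Set in
theorem integral_Ioi_line_sub_integral_Ioi_line {L a b : ℝ} {g : ℂ → ℂ}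
    (hg : Differentiable ℂ g)
    (h1 : IntegrableOn (fun x : ℝ => g (x + (a : ℝ) * Complex.I)) (Ioi L))
    (h2 : IntegrableOn (fun x : ℝ => g (x + (b : ℝ) * Complex.I)) (Ioi L))
    (h3 : Tendsto (fun T : ℝ => ∫ y in a..b, g (T + y * Complex.I)) atTop (nhds 0)) :
    (∫ x in Ioi L, g (x + (a : ℝ) * Complex.I)) - (∫ x in Ioi L, g (x + (b : ℝ) * Complex.I)) =
      Complex.I * ∫ y in a..b, g (L + y * Complex.I) := by
  have t := ((intervalIntegral_tendsto_integral_Ioi L h1 tendsto_id).sub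
    (intervalIntegral_tendsto_integral_Ioi L h2 tendsto_id)).add (h3.const_mul Complex.I)
  rw [mul_zero, add_zero] at t
  refine tendsto_nhds_unique t (tendsto_const_nhds.congr fun T => ?_)
  have h := Complex.integral_boundary_rect_eq_zero_of_differentiableOn g ⟨L, a⟩ ⟨T, b⟩
    hg.differentiableOn
  simp only [smul_eq_mul] at h
  simp only [id]
  linear_combination -h

theorem norm_hankelKernel (β x y : ℝ) :
    ‖hankelKernel β (x + y * Complex.I)‖ = Real.exp (Real.exp x * Real.cos y) *
      Real.exp (β * x) := by
  rw [hankelKernel, norm_mul, Complex.norm_exp, Complex.norm_exp, Complex.exp_re]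
  simp

theorem differentiable_hankelKernel (β : ℝ) : Differentiable ℂ (hankelKernel β) := by
  unfold hankelKernel
  fun_prop

theorem hasDerivAt_hankelKernel (β : ℝ) (v : ℂ) :
    HasDerivAt (hankelKernel β) (hankelKernel (β + 1) v + β * hankelKernel β v) v := by
  have h1 := (Complex.hasDerivAt_exp v).cexp
  have h2 := ((hasDerivAt_id v).const_mul (β : ℂ)).cexp
  refine (h1.mul h2).congr_deriv ?_
  simp only [hankelKernel, id]
  push_cast
  rw [add_mul (β : ℂ), Complex.exp_add, one_mul]
  ring

theorem exp_neg_mul_exp_mul_exp_le {c : ℝ} (hc : 0 < c) (β : ℝ) {x : ℝ} (hx : 0 ≤ x) :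
    Real.exp (-(c * Real.exp x)) * Real.exp (β * x) ≤
      Real.exp ((β + 1) ^ 2 / (2 * c)) * Real.exp (-1 * x) := by
  rw [← Real.exp_add, ← Real.exp_add, Real.exp_le_exp]
  have h := Real.quadratic_le_exp_of_nonneg hx
  have h' : c * (x ^ 2 / 2) ≤ c * Real.exp x := by gcongr; linarith
  have h2 : (β + 1) * x - c * (x ^ 2 / 2) ≤ (β + 1) ^ 2 / (2 * c) := by
    rw [le_div_iff₀ (by positivity)]
    nlinarith [sq_nonneg ((β + 1) - c * x)]
  linarith

open MeasureTheory Set in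
theorem integrableOn_exp_neg_mul_exp_mul_exp {c : ℝ} (hc : 0 < c) (β L : ℝ) :
    IntegrableOn (fun x : ℝ => Real.exp (-(c * Real.exp x)) * Real.exp (β * x)) (Ioi L) := by
  refine integrable_of_isBigO_exp_neg one_pos (by fun_prop)
    (IsBigO.of_bound (Real.exp ((β + 1) ^ 2 / (2 * c))) ?_)
  filter_upwards [eventually_ge_atTop 0] with x hx
  rw [Real.norm_of_nonneg (by positivity), Real.norm_of_nonneg (by positivity)]
  exact exp_neg_mul_exp_mul_exp_le hc β hx

theorem norm_hankelKernel_le {c y : ℝ} (hy : Real.cos y ≤ -c) (β x : ℝ) :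
    ‖hankelKernel β (x + y * Complex.I)‖ ≤
      Real.exp (-(c * Real.exp x)) * Real.exp (β * x) := by
  rw [norm_hankelKernel]
  gcongr
  nlinarith [Real.exp_pos x]

open MeasureTheory Set in
theorem integrableOn_hankelKernel {y : ℝ} (hy : Real.cos y < 0) (β L : ℝ) :
    IntegrableOn (fun x : ℝ => hankelKernel β (x + y * Complex.I)) (Ioi L) := by
  refine (integrableOn_exp_neg_mul_exp_mul_exp (neg_pos.2 hy) β L).mono' ?_
    (Eventually.of_forall fun x => norm_hankelKernel_le (by simp) β x)
  exact ((differentiable_hankelKernel β).continuous.comp (by fun_prop)).aestronglyMeasurable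

theorem tendsto_exp_neg_mul_exp_mul_exp {c : ℝ} (hc : 0 < c) (β : ℝ) :
    Tendsto (fun x : ℝ => Real.exp (-(c * Real.exp x)) * Real.exp (β * x)) atTop (nhds 0) := by
  have h : Tendsto (fun x : ℝ => Real.exp ((β + 1) ^ 2 / (2 * c)) * Real.exp (-1 * x)) atTop
      (nhds (Real.exp ((β + 1) ^ 2 / (2 * c)) * 0)) := by
    simp only [neg_one_mul]
    exact (Real.tendsto_exp_neg_atTop_nhds_zero).const_mul _
  rw [mul_zero] at h
  refine squeeze_zero' (Eventually.of_forall fun x => by positivity) ?_ h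
  filter_upwards [eventually_ge_atTop 0] with x hx using exp_neg_mul_exp_mul_exp_le hc β hx

theorem tendsto_hankelKernel {y : ℝ} (hy : Real.cos y < 0) (β : ℝ) :
    Tendsto (fun x : ℝ => hankelKernel β (x + y * Complex.I)) atTop (nhds 0) :=
  squeeze_zero_norm (fun x => norm_hankelKernel_le (c := -Real.cos y) (by simp) β x)
    (tendsto_exp_neg_mul_exp_mul_exp (neg_pos.2 hy) β)

theorem cos_neg_of_mem_Ioc {φ : ℝ} (h1 : Real.pi / 2 < φ) (h2 : φ ≤ Real.pi) : Real.cos φ < 0 :=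
  Real.cos_neg_of_pi_div_two_lt_of_lt h1 (by linarith [Real.pi_pos])

theorem hankelIntegral_hankelKernel_eq_of_le {L L' φ : ℝ} (hL : L' ≤ L)
    (h1 : Real.pi / 2 < φ) (h2 : φ ≤ Real.pi) (β : ℝ) :
    hankelIntegral L φ (hankelKernel β) = hankelIntegral L' φ (hankelKernel β) :=
  hankelIntegral_eq_of_le hL (by linarith [Real.pi_pos])
    (differentiable_hankelKernel β).differentiableOn
    (integrableOn_hankelKernel (cos_neg_of_mem_Ioc h1 h2) β L')
    (integrableOn_hankelKernel (by rw [Real.cos_neg]; exact cos_neg_of_mem_Ioc h1 h2) β L')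

theorem hankelIntegral_hankelKernel_eq (L L' : ℝ) {φ : ℝ}
    (h1 : Real.pi / 2 < φ) (h2 : φ ≤ Real.pi) (β : ℝ) :
    hankelIntegral L φ (hankelKernel β) = hankelIntegral L' φ (hankelKernel β) := by
  rcases le_total L L' with h | h
  · exact (hankelIntegral_hankelKernel_eq_of_le h h1 h2 β).symm
  · exact hankelIntegral_hankelKernel_eq_of_le h h1 h2 β

theorem tendsto_integral_hankelKernel {a b c : ℝ} (hc : 0 < c)
    (hab : ∀ y ∈ Set.uIoc a b, Real.cos y ≤ -c) (β : ℝ) :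
    Tendsto (fun T : ℝ => ∫ y in a..b, hankelKernel β (T + y * Complex.I)) atTop (nhds 0) := by
  refine squeeze_zero_norm (fun T => intervalIntegral.norm_integral_le_of_norm_le_const
    fun y hy => norm_hankelKernel_le (hab y hy) β T) ?_
  simpa using (tendsto_exp_neg_mul_exp_mul_exp hc β).mul_const |b - a|

theorem hankelIntegral_hankelKernel_eq_pi (L : ℝ) {φ : ℝ}
    (h1 : Real.pi / 2 < φ) (h2 : φ ≤ Real.pi) (β : ℝ) :
    hankelIntegral L φ (hankelKernel β) = hankelIntegral L Real.pi (hankelKernel β) := by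
  have hcos := cos_neg_of_mem_Ioc h1 h2
  have hpi := Real.pi_pos
  have hcos' : ∀ y, φ ≤ y → y ≤ Real.pi → Real.cos y ≤ -(-Real.cos φ) := fun y hy hy' => by
    rw [neg_neg]
    exact Real.cos_le_cos_of_nonneg_of_le_pi (by linarith) hy' hy
  have e1 := integral_Ioi_line_sub_integral_Ioi_line (L := L) (a := φ) (b := Real.pi)
    (differentiable_hankelKernel β)
    (integrableOn_hankelKernel hcos β L) (integrableOn_hankelKernel (by simp) β L)
    (tendsto_integral_hankelKernel (neg_pos.2 hcos) (fun y hy => by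
      rw [Set.uIoc_of_le h2] at hy
      exact hcos' y hy.1.le hy.2) β)
  have e2 := integral_Ioi_line_sub_integral_Ioi_line (L := L) (a := -Real.pi) (b := -φ)
    (differentiable_hankelKernel β)
    (integrableOn_hankelKernel (by simp) β L)
    (integrableOn_hankelKernel (by rwa [Real.cos_neg]) β L)
    (tendsto_integral_hankelKernel (neg_pos.2 hcos) (fun y hy => by
      rw [Set.uIoc_of_le (by linarith)] at hy
      rw [← Real.cos_neg y]
      exact hcos' _ (by linarith [hy.2]) (by linarith [hy.1])) β)
  have hi (a b : ℝ) : IntervalIntegrable (fun y : ℝ => hankelKernel β (L + y * Complex.I))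
      MeasureTheory.volume a b :=
    ((differentiable_hankelKernel β).continuous.comp (by fun_prop)).intervalIntegrable _ _
  have e3 := intervalIntegral.integral_add_adjacent_intervals (hi (-Real.pi) (-φ)) (hi (-φ) φ)
  have e4 := intervalIntegral.integral_add_adjacent_intervals (hi (-Real.pi) φ) (hi φ Real.pi)
  rw [hankelIntegral, hankelIntegral]
  linear_combination e1 + e2 + Complex.I * e3 + Complex.I * e4

theorem hankelIntegral_hankelKernel_recurrence (L : ℝ) {φ : ℝ}
    (h1 : Real.pi / 2 < φ) (h2 : φ ≤ Real.pi) (β : ℝ) :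
    hankelIntegral L φ (hankelKernel (β + 1)) =
      -β * hankelIntegral L φ (hankelKernel β) := by
  have hcos := cos_neg_of_mem_Ioc h1 h2
  have hcos' : Real.cos (-φ) < 0 := by rwa [Real.cos_neg]
  have line {y : ℝ} (hy : Real.cos y < 0) :
      (∫ x in Set.Ioi L, hankelKernel (β + 1) (x + y * Complex.I)) +
        β * ∫ x in Set.Ioi L, hankelKernel β (x + y * Complex.I) =
      0 - hankelKernel β (L + y * Complex.I) := by
    have i1 := integrableOn_hankelKernel hy (β + 1) L
    have i2 := (integrableOn_hankelKernel hy β L).const_mul (β : ℂ)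
    rw [← MeasureTheory.integral_const_mul, ← MeasureTheory.integral_add i1 i2]
    refine MeasureTheory.integral_Ioi_of_hasDerivAt_of_tendsto'
      (f := fun x : ℝ => hankelKernel β (x + y * Complex.I)) (fun x _ => ?_) (i1.add i2)
      (tendsto_hankelKernel hy β)
    exact ((hasDerivAt_hankelKernel β _).comp_add_const (x : ℂ) (y * Complex.I)).comp_ofReal
  have i (β' : ℝ) : IntervalIntegrable (fun y : ℝ => hankelKernel β' (L + y * Complex.I))
      MeasureTheory.volume (-φ) φ :=
    ((differentiable_hankelKernel β').continuous.comp (by fun_prop)).intervalIntegrable _ _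
  have vert : Complex.I * ((∫ y in (-φ)..φ, hankelKernel (β + 1) (L + y * Complex.I)) +
        β * ∫ y in (-φ)..φ, hankelKernel β (L + y * Complex.I)) =
      hankelKernel β (L + (φ : ℝ) * Complex.I) -
        hankelKernel β (L + ((-φ : ℝ) : ℂ) * Complex.I) := by
    rw [← intervalIntegral.integral_const_mul,
      ← intervalIntegral.integral_add (i _) ((i β).const_mul (β : ℂ)),
      ← intervalIntegral.integral_const_mul]
    refine intervalIntegral.integral_eq_sub_of_hasDerivAt
      (f := fun y : ℝ => hankelKernel β (L + y * Complex.I)) (fun y _ => ?_)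
      (((i _).add ((i β).const_mul (β : ℂ))).const_mul Complex.I)
    have h := ((hasDerivAt_id (y : ℂ)).mul_const Complex.I).const_add (L : ℂ)
    have := ((hasDerivAt_hankelKernel β ((L : ℂ) + y * Complex.I)).comp (y : ℂ) h).comp_ofReal
    simpa [mul_comm] using this
  have l1 := line hcos
  have l2 := line hcos'
  rw [hankelIntegral, hankelIntegral]
  linear_combination l1 - l2 + vert

open MeasureTheory Set in
theorem hankelIntegral_hankelKernel_of_mem_Ioo {β : ℝ} (hβ : 0 < β) (hβ' : β < 1) (L₀ : ℝ) :
    hankelIntegral L₀ Real.pi (hankelKernel β) =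
      2 * Real.pi * Complex.I * ((1 / Real.Gamma (1 - β) : ℝ) : ℂ) := by
  have hpi := Real.pi_pos
  have line (L : ℝ) (σ : ℝ) (hσ : Complex.exp (σ * Complex.I) = -1) :
      (∫ x in Ioi L, hankelKernel β (x + σ * Complex.I)) =
      Complex.exp (β * σ * Complex.I) *
        ((∫ r in Ioi (Real.exp L), Real.exp (-r) * r ^ (β - 1) : ℝ) : ℂ) := by
    rw [← integral_comp_exp_Ioi, ← integral_complex_ofReal, ← integral_const_mul]
    refine integral_congr_ae (Eventually.of_forall fun x => ?_)
    have hr : Real.exp x * Real.exp x ^ (β - 1) = Real.exp (β * x) := by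
      rw [← Real.exp_mul, ← Real.exp_add]; ring_nf
    have hr' : Real.exp x * (Real.exp (-Real.exp x) * Real.exp x ^ (β - 1)) =
        Real.exp (-Real.exp x) * Real.exp (β * x) := by rw [← hr]; ring
    simp only [hankelKernel, smul_eq_mul]
    rw [hr', Complex.exp_add, hσ, mul_add, Complex.exp_add]
    push_cast
    ring_nf
  have hexp : Complex.exp ((Real.pi : ℝ) * Complex.I) = -1 := Complex.exp_pi_mul_I
  have hexp' : Complex.exp (((-Real.pi : ℝ) : ℂ) * Complex.I) = -1 := by
    push_cast
    rw [neg_mul, Complex.exp_neg, Complex.exp_pi_mul_I]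
    norm_num
  have key (L : ℝ) : hankelIntegral L₀ Real.pi (hankelKernel β) =
      2 * Complex.I * (Real.sin (Real.pi * β) : ℝ) *
        ((∫ r in Ioi (Real.exp L), Real.exp (-r) * r ^ (β - 1) : ℝ) : ℂ) +
      Complex.I * ∫ y in (-Real.pi)..Real.pi, hankelKernel β (L + y * Complex.I) := by
    rw [hankelIntegral_hankelKernel_eq L₀ L (by linarith) le_rfl, hankelIntegral,
      line L _ hexp, line L _ hexp', Complex.ofReal_sin, Complex.sin]
    push_cast
    have e1 : (-(Real.pi * β : ℂ) * Complex.I) = β * -Real.pi * Complex.I := by ring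
    have e2 : ((Real.pi * β : ℂ) * Complex.I) = β * Real.pi * Complex.I := by ring
    rw [e1, e2]
    linear_combination ((Complex.exp (β * Real.pi * Complex.I) -
      Complex.exp (β * -Real.pi * Complex.I)) *
      ((∫ r in Ioi (Real.exp L), Real.exp (-r) * r ^ (β - 1) : ℝ) : ℂ)) * Complex.I_sq
  have t1 : Tendsto (fun L : ℝ => ∫ r in Ioi (Real.exp L), Real.exp (-r) * r ^ (β - 1)) atBot
      (nhds (Real.Gamma β)) := by
    rw [Real.Gamma_eq_integral hβ]
    have hc : AECover (volume.restrict (Ioi (0 : ℝ))) atBot fun L : ℝ => Ioi (Real.exp L) :=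
      aecover_Ioi_of_Ioi Real.tendsto_exp_atBot
    refine (hc.integral_tendsto_of_countably_generated
      (Real.GammaIntegral_convergent hβ)).congr fun L => ?_
    rw [Measure.restrict_restrict measurableSet_Ioi, inter_eq_left.2
      (Ioi_subset_Ioi (Real.exp_pos L).le)]
  have t2 : Tendsto (fun L : ℝ => ∫ y in (-Real.pi)..Real.pi, hankelKernel β (L + y * Complex.I))
      atBot (nhds 0) := by
    have hb : Tendsto (fun L : ℝ => Real.exp (Real.exp L) * Real.exp (β * L) *
        |Real.pi - -Real.pi|) atBot (nhds (Real.exp 0 * 0 * |Real.pi - -Real.pi|)) := by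
      refine Tendsto.mul_const _ (Tendsto.mul ?_ ?_)
      · exact (Real.continuous_exp.tendsto 0).comp Real.tendsto_exp_atBot
      · exact Real.tendsto_exp_atBot.comp (tendsto_id.const_mul_atBot hβ)
    rw [mul_zero, zero_mul] at hb
    refine squeeze_zero_norm (fun L => intervalIntegral.norm_integral_le_of_norm_le_const
      fun y _ => ?_) hb
    rw [norm_hankelKernel]
    gcongr
    nlinarith [Real.exp_pos L, Real.cos_le_one y]
  have t := (((Complex.continuous_ofReal.tendsto _).comp t1).const_mul
    (2 * Complex.I * (Real.sin (Real.pi * β) : ℝ))).add (t2.const_mul Complex.I)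
  have h := tendsto_nhds_unique (tendsto_const_nhds.congr key) t
  have hG := Real.Gamma_mul_Gamma_one_sub β
  have hs : 0 < Real.sin (Real.pi * β) := Real.sin_pos_of_pos_of_lt_pi (by positivity) (by nlinarith)
  have hΓ : 0 < Real.Gamma (1 - β) := Real.Gamma_pos_of_pos (by linarith)
  have hG' : Real.sin (Real.pi * β) * Real.Gamma β = Real.pi * (1 / Real.Gamma (1 - β)) := by
    rw [eq_div_iff hs.ne'] at hG
    rw [mul_one_div, eq_div_iff hΓ.ne']
    linear_combination hG
  rw [h, mul_zero, add_zero, mul_assoc, ← Complex.ofReal_mul, hG']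
  push_cast
  ring

open MeasureTheory Set in
theorem continuousAt_hankelIntegral_hankelKernel :
    ContinuousAt (fun β : ℝ => hankelIntegral 0 Real.pi (hankelKernel β)) 0 := by
  have hcont (v : ℂ) : Continuous fun β : ℝ => hankelKernel β v := by
    unfold hankelKernel; fun_prop
  have line {y : ℝ} (hy : Real.cos y < 0) : ContinuousAt (fun β : ℝ =>
      ∫ x in Ioi (0 : ℝ), hankelKernel β (x + y * Complex.I)) 0 := by
    refine continuousAt_of_dominated
      (bound := fun x => Real.exp (-(-Real.cos y * Real.exp x)) * Real.exp (1 * x))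
      (Eventually.of_forall fun β => ?_) ?_
      (integrableOn_exp_neg_mul_exp_mul_exp (neg_pos.2 hy) 1 0)
      (Eventually.of_forall fun x => (hcont _).continuousAt)
    · exact ((differentiable_hankelKernel β).continuous.comp (by fun_prop)).aestronglyMeasurable
    · filter_upwards [eventually_le_nhds (zero_lt_one' ℝ)] with β hβ
      filter_upwards [ae_restrict_mem measurableSet_Ioi] with x hx
      have := mem_Ioi.1 hx
      refine (norm_hankelKernel_le (c := -Real.cos y) (by simp) β x).trans ?_
      gcongr
  unfold hankelIntegral
  refine ((line (by simp)).sub (line (by simp))).add (continuousAt_const.mul ?_)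
  refine (intervalIntegral.continuous_parametric_intervalIntegral_of_continuous' ?_ _ _).continuousAt
  simp only [hankelKernel]
  fun_prop

/-- Hankel's formula for the reciprocal Gamma function. -/
theorem hankelIntegral_hankelKernel {φ : ℝ} (h1 : Real.pi / 2 < φ) (h2 : φ ≤ Real.pi) (L : ℝ)
    {s : ℝ} (hs : 0 ≤ s) :
    hankelIntegral L φ (hankelKernel (1 - s)) =
      2 * Real.pi * Complex.I * ((1 / Real.Gamma s : ℝ) : ℂ) := by
  have hpi := Real.pi_pos
  have h3 : Real.pi / 2 < Real.pi := by linarith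
  rw [hankelIntegral_hankelKernel_eq_pi L h1 h2, hankelIntegral_hankelKernel_eq L 0 h3 le_rfl]
  have at_one : hankelIntegral 0 Real.pi (hankelKernel 0) =
      2 * Real.pi * Complex.I * ((1 / Real.Gamma 1 : ℝ) : ℂ) := by
    have hΓ : ContinuousAt (fun β : ℝ =>
        2 * Real.pi * Complex.I * ((1 / Real.Gamma (1 - β) : ℝ) : ℂ)) 0 := by
      refine continuousAt_const.mul (Complex.continuous_ofReal.continuousAt.comp ?_)
      have hG : ContinuousAt Real.Gamma (1 - 0) := by
        rw [sub_zero]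
        exact (Real.differentiableAt_Gamma fun m => by
          have : (0 : ℝ) ≤ m := m.cast_nonneg
          linarith).continuousAt
      refine continuousAt_const.div (ContinuousAt.comp (f := fun β : ℝ => 1 - β) hG
        (by fun_prop)) ?_
      simp
    have t1 := continuousAt_hankelIntegral_hankelKernel.tendsto.mono_left
      (nhdsWithin_le_nhds (s := Set.Ioi 0))
    have t2 := hΓ.tendsto.mono_left (nhdsWithin_le_nhds (s := Set.Ioi 0))
    simp only [sub_zero] at t2
    refine tendsto_nhds_unique t1 (t2.congr' ?_)
    filter_upwards [Ioo_mem_nhdsGT (zero_lt_one' ℝ)] with β hβ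
    exact (hankelIntegral_hankelKernel_of_mem_Ioo hβ.1 hβ.2 0).symm
  have step (n : ℕ) : ∀ s : ℝ, (n : ℝ) < s → s ≤ n + 1 →
      hankelIntegral 0 Real.pi (hankelKernel (1 - s)) =
        2 * Real.pi * Complex.I * ((1 / Real.Gamma s : ℝ) : ℂ) := by
    induction n with
    | zero =>
      intro s hs hs'
      simp only [Nat.cast_zero, zero_add] at hs hs'
      rcases hs'.lt_or_eq with hlt | rfl
      · have := hankelIntegral_hankelKernel_of_mem_Ioo (β := 1 - s) (by linarith) (by linarith) 0
        rwa [sub_sub_cancel] at this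
      · rw [sub_self, at_one]
    | succ n ih =>
      intro s hs hs'
      push_cast at hs hs'
      have hs1 : 0 < s - 1 := by
        have : (0 : ℝ) ≤ n := n.cast_nonneg
        linarith
      have h := ih (s - 1) (by linarith) (by linarith)
      have hrec := hankelIntegral_hankelKernel_recurrence 0 h3 le_rfl (1 - s)
      have hG := Real.Gamma_add_one hs1.ne'
      rw [sub_add_cancel] at hG
      rw [show 1 - s + 1 = 1 - (s - 1) by ring, h] at hrec
      have hne : ((s : ℂ) - 1) ≠ 0 := by exact_mod_cast hs1.ne'
      rw [hG]
      refine mul_left_cancel₀ hne ?_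
      push_cast at hrec ⊢
      rw [mul_left_comm, one_div (((s : ℂ) - 1) * _), mul_inv, mul_inv_cancel_left₀ hne, ← one_div]
      linear_combination -hrec
  rcases hs.eq_or_lt with rfl | hpos
  · have hrec := hankelIntegral_hankelKernel_recurrence 0 h3 le_rfl 0
    rw [zero_add] at hrec
    rw [sub_zero, hrec]
    simp
  · obtain ⟨n, hn⟩ : ∃ n : ℕ, ⌈s⌉₊ = n + 1 :=
      Nat.exists_eq_succ_of_ne_zero (Nat.ceil_pos.2 hpos).ne'
    have h := Nat.ceil_eq_iff (n := n + 1) (a := s) (by simp)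
    have h' := h.1 hn
    simp only [Nat.add_sub_cancel] at h'
    exact step n s h'.1 (by exact_mod_cast h'.2)

theorem re_mul_conj_le_of_arg {a w : ℂ} {θ δ : ℝ} (ha : a = ‖a‖ * Complex.exp (θ * Complex.I))
    (h1 : |θ| + δ ≤ |w.arg|) (h2 : |θ| + δ ≤ Real.pi) (hδ : 0 ≤ δ) :
    (a * (starRingEnd ℂ) w).re ≤ ‖a‖ * ‖w‖ * Real.cos δ := by
  have hw : (starRingEnd ℂ) w = ‖w‖ * Complex.exp (-(w.arg * Complex.I)) := by
    conv_lhs => rw [← Complex.norm_mul_exp_arg_mul_I w]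
    rw [map_mul, Complex.conj_ofReal, ← Complex.exp_conj, map_mul, Complex.conj_I,
      Complex.conj_ofReal, mul_neg]
  have hre : (a * (starRingEnd ℂ) w).re = ‖a‖ * ‖w‖ * Real.cos |θ - w.arg| := by
    conv_lhs => rw [ha, hw]
    rw [show (‖a‖ : ℂ) * Complex.exp (θ * Complex.I) * (‖w‖ * Complex.exp (-(w.arg * Complex.I))) =
      ((‖a‖ * ‖w‖ : ℝ) : ℂ) * Complex.exp (((θ - w.arg : ℝ) : ℂ) * Complex.I) by
        rw [mul_mul_mul_comm, ← Complex.exp_add]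
        push_cast
        ring_nf, Complex.re_ofReal_mul, Complex.exp_ofReal_mul_I_re, Real.cos_abs]
  rw [hre]
  gcongr
  have hge : δ ≤ |θ - w.arg| := by
    have := abs_sub_abs_le_abs_sub w.arg θ
    rw [abs_sub_comm] at this
    linarith
  have hle : |θ - w.arg| ≤ 2 * Real.pi - δ := by
    have h := abs_sub θ w.arg
    have := Complex.abs_arg_le_pi w
    linarith
  rcases le_total |θ - w.arg| Real.pi with h | h
  · exact Real.cos_le_cos_of_nonneg_of_le_pi hδ h hge
  · rw [← Real.cos_two_pi_sub |θ - w.arg|]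
    exact Real.cos_le_cos_of_nonneg_of_le_pi hδ (by linarith) (by linarith)

theorem sqrt_mul_norm_le_norm_sub {a w : ℂ} {μ : ℝ} (h0 : 0 ≤ μ) (h1 : μ ≤ 1)
    (h : (a * (starRingEnd ℂ) w).re ≤ ‖a‖ * ‖w‖ * μ) :
    Real.sqrt (1 - μ) * ‖w‖ ≤ ‖a - w‖ := by
  refine abs_le_of_sq_le_sq' ?_ (norm_nonneg _) |>.2
  rw [mul_pow, Real.sq_sqrt (by linarith), Complex.sq_norm (a - w), Complex.normSq_sub,
    ← Complex.sq_norm, ← Complex.sq_norm]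
  nlinarith [mul_nonneg h0 (sq_nonneg (‖a‖ - ‖w‖)), mul_nonneg (sub_nonneg.2 h1) (sq_nonneg ‖a‖)]

theorem exists_hankel_angle {α c : ℝ} (hα : 0 < α) (hα' : α ≤ 1)
    (hc : c < Real.cos (Real.pi * α / 2)) :
    ∃ φ κ : ℝ, Real.pi / 2 < φ ∧ φ ≤ Real.pi ∧ 0 < κ ∧ ∀ v w : ℂ, |v.im| ≤ φ →
      w.re ≤ c * ‖w‖ → κ * ‖w‖ ≤ ‖Complex.exp (α * v) - w‖ := by
  have hpi := Real.pi_pos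
  have hcos : 0 ≤ Real.cos (Real.pi * α / 2) :=
    Real.cos_nonneg_of_neg_pi_div_two_le_of_le (by nlinarith) (by nlinarith)
  set Θ := Real.arccos (max c (-1)) with hΘ
  have hcosΘ : Real.cos Θ = max c (-1) :=
    Real.cos_arccos (le_max_right _ _) (max_le (hc.le.trans (Real.cos_le_one _)) (by norm_num))
  have hΘ0 : 0 ≤ Θ := Real.arccos_nonneg _
  have hΘπ : Θ ≤ Real.pi := Real.arccos_le_pi _
  have hΘα : Real.pi * α / 2 < Θ := by
    by_contra! hle
    have := Real.cos_le_cos_of_nonneg_of_le_pi hΘ0 (by nlinarith) hle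
    rw [hcosΘ] at this
    exact absurd this (not_le.2 (max_lt hc (by linarith)))
  have hdiv : Real.pi / 2 < Θ / α := by rw [lt_div_iff₀ hα]; linarith
  set φ := min Real.pi ((Real.pi / 2 + Θ / α) / 2) with hφ
  have hφ1 : Real.pi / 2 < φ := lt_min (by linarith) (by linarith)
  have hφπ : φ ≤ Real.pi := min_le_left _ _
  have hφΘ : φ < Θ / α := (min_le_right _ _).trans_lt (by linarith)
  rw [lt_div_iff₀ hα] at hφΘ
  set δ := Θ - φ * α with hδdef
  have hδ : 0 < δ := by linarith
  have hδπ : δ ≤ Real.pi := by nlinarith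
  have hμ1 : max (Real.cos δ) 0 < 1 := by
    refine max_lt ?_ one_pos
    rw [← Real.cos_zero]
    exact Real.cos_lt_cos_of_nonneg_of_le_pi le_rfl hδπ hδ
  refine ⟨φ, Real.sqrt (1 - max (Real.cos δ) 0), hφ1, hφπ, Real.sqrt_pos.2 (by linarith),
    fun v w hv hw => sqrt_mul_norm_le_norm_sub (le_max_right _ _) hμ1.le ?_⟩
  rcases eq_or_ne w 0 with rfl | hw0
  · simp
  have hwpos : 0 < ‖w‖ := norm_pos_iff.2 hw0
  have harg : Θ ≤ |w.arg| := by
    by_contra! hlt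
    have h1 := Real.cos_lt_cos_of_nonneg_of_le_pi (abs_nonneg _) hΘπ hlt
    rw [Real.cos_abs, Complex.cos_arg hw0, hcosΘ, lt_div_iff₀ hwpos] at h1
    nlinarith [le_max_left c (-1)]
  refine (re_mul_conj_le_of_arg (θ := α * v.im) (δ := δ) ?_ ?_ ?_ hδ.le).trans ?_
  · rw [Complex.norm_exp, Complex.ofReal_exp, ← Complex.exp_add]
    congr 1
    apply Complex.ext <;> simp
  · rw [abs_mul, abs_of_pos hα]
    nlinarith
  · rw [abs_mul, abs_of_pos hα]
    nlinarith
  · gcongr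
    exact le_max_left _ _

/-- The Hankel integrand of the Mittag-Leffler function. -/
noncomputable def mittagLefflerKernel (α : ℝ) (w v : ℂ) : ℂ :=
  Complex.exp (Complex.exp v) * (Complex.exp (α * v) / (Complex.exp (α * v) - w))

theorem hasSum_mittagLefflerKernel {α : ℝ} {w v : ℂ} (h : ‖w‖ < Real.exp (α * v.re)) :
    HasSum (fun m : ℕ => w ^ m * hankelKernel (1 - (α * m + 1)) v) (mittagLefflerKernel α w v) := by
  have hr : ‖w * Complex.exp (-(α * v))‖ < 1 := by
    rw [norm_mul, Complex.norm_exp]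
    simp only [Complex.neg_re, Complex.re_ofReal_mul]
    rw [Real.exp_neg, ← div_eq_mul_inv, div_lt_one (Real.exp_pos _)]
    exact h
  have hne : Complex.exp (α * v) - w ≠ 0 := by
    intro h0
    rw [← sub_eq_zero.1 h0, Complex.norm_exp, Complex.re_ofReal_mul] at h
    exact lt_irrefl _ h
  have hs := (hasSum_geometric_of_norm_lt_one hr).mul_left (Complex.exp (Complex.exp v))
  have e1 : Complex.exp (Complex.exp v) * (1 - w * Complex.exp (-(α * v)))⁻¹ =
      mittagLefflerKernel α w v := by
    have h0 := Complex.exp_ne_zero (α * v)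
    rw [mittagLefflerKernel, Complex.exp_neg]
    congr 1
    rw [eq_div_iff hne, ← div_eq_mul_inv, one_sub_div h0, inv_div, div_mul_cancel₀ _ hne]
  rw [e1] at hs
  refine (congrArg (fun f => HasSum f _) (funext fun m => ?_)).mp hs
  rw [hankelKernel, mul_pow, ← Complex.exp_nat_mul, mul_left_comm]
  congr 3
  push_cast
  ring

theorem norm_pow_mul_hankelKernel_le {α : ℝ} (hα : 0 < α) {w : ℂ} {L x : ℝ} (hx : L ≤ x) (y : ℝ)
    (m : ℕ) : ‖w ^ m * hankelKernel (1 - (α * m + 1)) (x + y * Complex.I)‖ ≤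
      (‖w‖ / Real.exp (α * L)) ^ m * ‖hankelKernel 0 (x + y * Complex.I)‖ := by
  rw [norm_mul, norm_pow, norm_hankelKernel, norm_hankelKernel, zero_mul, Real.exp_zero, mul_one,
    div_pow, ← Real.exp_nat_mul, div_eq_mul_inv, ← Real.exp_neg, mul_assoc,
    mul_comm (Real.exp (Real.exp x * Real.cos y))]
  gcongr
  have : α * L * m ≤ α * x * m := by gcongr
  linarith

open MeasureTheory Set in
theorem mittagLeffler_eq_hankelIntegral {α : ℝ} (hα : 0 < α) {φ L : ℝ}
    (h1 : Real.pi / 2 < φ) (h2 : φ ≤ Real.pi) {w : ℂ} (hw : ‖w‖ < Real.exp (α * L)) :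
    hankelIntegral L φ (mittagLefflerKernel α w) =
      2 * Real.pi * Complex.I * mittagLeffler α w := by
  have hr : ‖w‖ / Real.exp (α * L) < 1 := by rwa [div_lt_one (Real.exp_pos _)]
  have hgeo := summable_geometric_of_lt_one (by positivity) hr
  have hcont (β : ℝ) (f : ℝ → ℂ) (hf : Continuous f) (m : ℕ) :
      Continuous fun x => w ^ m * hankelKernel β (f x) :=
    ((differentiable_hankelKernel β).continuous.comp hf).const_mul _
  have line {y : ℝ} (hy : Real.cos y < 0) :
      HasSum (fun m : ℕ => ∫ x in Ioi L, w ^ m * hankelKernel (1 - (α * m + 1))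
        (x + y * Complex.I)) (∫ x in Ioi L, mittagLefflerKernel α w (x + y * Complex.I)) := by
    refine hasSum_integral_of_dominated_convergence
      (fun m x => (‖w‖ / Real.exp (α * L)) ^ m * ‖hankelKernel 0 (x + y * Complex.I)‖)
      (fun m => (hcont _ _ (by fun_prop) m).aestronglyMeasurable) (fun m => ?_)
      (Eventually.of_forall fun x => hgeo.mul_right _) ?_ ?_
    · filter_upwards [ae_restrict_mem measurableSet_Ioi] with x hx
      exact norm_pow_mul_hankelKernel_le hα (mem_Ioi.1 hx).le y m
    · simp only [tsum_mul_right]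
      exact (integrableOn_hankelKernel hy 0 L).norm.const_mul _
    · filter_upwards [ae_restrict_mem measurableSet_Ioi] with x hx
      refine hasSum_mittagLefflerKernel (hw.trans_le ?_)
      have := (mem_Ioi.1 hx).le
      simp only [Complex.add_re, Complex.ofReal_re, Complex.re_ofReal_mul, Complex.I_re, mul_zero,
        add_zero]
      gcongr
  have vert : HasSum (fun m : ℕ => ∫ y in (-φ)..φ, w ^ m * hankelKernel (1 - (α * m + 1))
        (L + y * Complex.I)) (∫ y in (-φ)..φ, mittagLefflerKernel α w (L + y * Complex.I)) := by
    refine intervalIntegral.hasSum_integral_of_dominated_convergence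
      (fun m y => (‖w‖ / Real.exp (α * L)) ^ m * ‖hankelKernel 0 (L + y * Complex.I)‖)
      (fun m => (hcont _ _ (by fun_prop) m).aestronglyMeasurable)
      (fun m => Eventually.of_forall fun y _ => norm_pow_mul_hankelKernel_le hα le_rfl y m)
      (Eventually.of_forall fun x _ => hgeo.mul_right _) ?_ ?_
    · simp only [tsum_mul_right]
      exact (((differentiable_hankelKernel 0).continuous.comp (by fun_prop)).norm.const_mul
        _).intervalIntegrable _ _
    · refine Eventually.of_forall fun y _ => hasSum_mittagLefflerKernel (hw.trans_le ?_)
      simp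
  have hs := ((line (cos_neg_of_mem_Ioc h1 h2)).sub
    (line (y := -φ) (by rw [Real.cos_neg]; exact cos_neg_of_mem_Ioc h1 h2))).add
    (vert.mul_left Complex.I)
  have hs' := (summable_mittagLeffler hα w).hasSum.mul_left (2 * Real.pi * Complex.I)
  refine HasSum.unique hs ?_
  refine (congrArg (fun f => HasSum f _) (funext fun m => ?_)).mp hs'
  have h := hankelIntegral_hankelKernel h1 h2 L (s := α * m + 1) (by positivity)
  rw [hankelIntegral] at h
  rw [integral_const_mul, integral_const_mul, intervalIntegral.integral_const_mul]
  push_cast at h ⊢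
  linear_combination -w ^ m * h

open MeasureTheory Set in
theorem norm_hankelIntegral_le {φ β C L : ℝ} (h1 : Real.pi / 2 < φ) (h2 : φ ≤ Real.pi)
    {g : ℂ → ℂ} (hg : ∀ v : ℂ, |v.im| ≤ φ → ‖g v‖ ≤ C * ‖hankelKernel β v‖) :
    ‖hankelIntegral L φ g‖ ≤ C *
      ((∫ x in Ioi L, ‖hankelKernel β (x + (φ : ℝ) * Complex.I)‖) +
        (∫ x in Ioi L, ‖hankelKernel β (x + ((-φ : ℝ) : ℂ) * Complex.I)‖) +
        ∫ y in (-φ)..φ, ‖hankelKernel β (L + y * Complex.I)‖) := by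
  have hφ : 0 < φ := by linarith [Real.pi_pos]
  have line {y : ℝ} (hy : Real.cos y < 0) (hy' : |y| ≤ φ) :
      ‖∫ x in Ioi L, g (x + y * Complex.I)‖ ≤
        C * ∫ x in Ioi L, ‖hankelKernel β (x + y * Complex.I)‖ := by
    rw [← integral_const_mul]
    exact norm_integral_le_of_norm_le ((integrableOn_hankelKernel hy β L).norm.const_mul C)
      (Eventually.of_forall fun x => hg _ (by simpa using hy'))
  have l1 := line (cos_neg_of_mem_Ioc h1 h2) (abs_of_pos hφ).le
  have l2 := line (y := -φ) (by rw [Real.cos_neg]; exact cos_neg_of_mem_Ioc h1 h2)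
    (by rw [abs_neg, abs_of_pos hφ])
  have l3 : ‖∫ y in (-φ)..φ, g (L + y * Complex.I)‖ ≤
      C * ∫ y in (-φ)..φ, ‖hankelKernel β (L + y * Complex.I)‖ := by
    rw [← intervalIntegral.integral_const_mul]
    refine intervalIntegral.norm_integral_le_of_norm_le (by linarith)
      (Eventually.of_forall fun y hy => hg _ ?_)
      ((((differentiable_hankelKernel β).continuous.comp (by fun_prop)).norm.const_mul
        _).intervalIntegrable _ _)
    simpa using abs_le.2 ⟨hy.1.le, hy.2⟩
  have h := norm_add_le ((∫ x in Ioi L, g (x + (φ : ℝ) * Complex.I)) -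
    (∫ x in Ioi L, g (x + ((-φ : ℝ) : ℂ) * Complex.I)))
    (Complex.I * ∫ y in (-φ)..φ, g (L + y * Complex.I))
  have h' := norm_sub_le (∫ x in Ioi L, g (x + (φ : ℝ) * Complex.I))
    (∫ x in Ioi L, g (x + ((-φ : ℝ) : ℂ) * Complex.I))
  rw [norm_mul, Complex.norm_I, one_mul] at h
  rw [hankelIntegral]
  linarith

/-- Asymptotics of the Mittag-Leffler function outside a closed sector that contains
`|arg w| ≤ πα/2` in its interior. -/
theorem exists_norm_mittagLeffler_add_le {α c : ℝ} (hα : 0 < α) (hα' : α ≤ 1)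
    (hc : c < Real.cos (Real.pi * α / 2)) :
    ∃ M : ℝ, 0 ≤ M ∧ ∀ w : ℂ, w ≠ 0 → w.re ≤ c * ‖w‖ →
      ‖mittagLeffler α w + ((1 / Real.Gamma (1 - α) : ℝ) : ℂ) / w‖ ≤ M / ‖w‖ ^ 2 := by
  obtain ⟨φ, κ, h1, h2, hκ, hsep⟩ := exists_hankel_angle hα hα' hc
  have hpi := Real.pi_pos
  have hφ : 0 < φ := by linarith
  have hcos := cos_neg_of_mem_Ioc h1 h2
  have hcos' : Real.cos (-φ) < 0 := by rwa [Real.cos_neg]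
  set N : ℝ := (∫ x in Set.Ioi (0 : ℝ), ‖hankelKernel (2 * α) (x + (φ : ℝ) * Complex.I)‖) +
        (∫ x in Set.Ioi (0 : ℝ), ‖hankelKernel (2 * α) (x + ((-φ : ℝ) : ℂ) * Complex.I)‖) +
        ∫ y in (-φ)..φ, ‖hankelKernel (2 * α) ((0 : ℝ) + y * Complex.I)‖ with hN
  have hN0 : 0 ≤ N := by
    refine add_nonneg (add_nonneg ?_ ?_) ?_
    · exact MeasureTheory.integral_nonneg fun x => norm_nonneg _
    · exact MeasureTheory.integral_nonneg fun x => norm_nonneg _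
    · exact intervalIntegral.integral_nonneg (by linarith) fun x _ => norm_nonneg _
  refine ⟨N / (2 * Real.pi * κ), by positivity, fun w hw0 hw => ?_⟩
  have hwpos : 0 < ‖w‖ := norm_pos_iff.2 hw0
  have hden (v : ℂ) (hv : |v.im| ≤ φ) : 0 < ‖Complex.exp (α * v) - w‖ :=
    (mul_pos hκ hwpos).trans_le (hsep v w hv hw)
  have hdiff (v : ℂ) (hv : |v.im| ≤ φ) : DifferentiableAt ℂ (mittagLefflerKernel α w) v := by
    unfold mittagLefflerKernel
    have hne := norm_pos_iff.1 (hden v hv)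
    fun_prop (disch := assumption)
  have hcontLine (L : ℝ) {y : ℝ} (hy : |y| ≤ φ) :
      Continuous fun x : ℝ => mittagLefflerKernel α w (x + y * Complex.I) :=
    continuous_iff_continuousAt.2 fun x => ContinuousAt.comp
      (f := fun x : ℝ => (x : ℂ) + y * Complex.I) (hdiff _ (by simpa using hy)).continuousAt
      (by fun_prop)
  have hbound (v : ℂ) (hv : |v.im| ≤ φ) :
      ‖mittagLefflerKernel α w v‖ ≤ (κ * ‖w‖)⁻¹ * ‖hankelKernel α v‖ := by
    rw [mittagLefflerKernel, hankelKernel, ← mul_div_assoc, norm_div, div_eq_inv_mul]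
    gcongr
    exact hsep v w hv hw
  have hint (L : ℝ) {y : ℝ} (hy : Real.cos y < 0) (hy' : |y| ≤ φ) :
      MeasureTheory.IntegrableOn
        (fun x : ℝ => mittagLefflerKernel α w (x + y * Complex.I)) (Set.Ioi L) :=
    ((integrableOn_hankelKernel hy α L).norm.const_mul _).mono'
      (hcontLine L hy').aestronglyMeasurable
      (Eventually.of_forall fun x => hbound _ (by simpa using hy'))
  have habs : |φ| ≤ φ := (abs_of_pos hφ).le
  have habs' : |(-φ)| ≤ φ := by rwa [abs_neg]
  obtain ⟨L, hL0, hL⟩ : ∃ L : ℝ, 0 ≤ L ∧ ‖w‖ < Real.exp (α * L) := by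
    refine ⟨‖w‖ / α, by positivity, ?_⟩
    rw [mul_div_cancel₀ _ hα.ne']
    exact (lt_add_one _).trans_le (Real.add_one_le_exp _)
  have hE : hankelIntegral 0 φ (mittagLefflerKernel α w) =
      2 * Real.pi * Complex.I * mittagLeffler α w := by
    rw [← mittagLeffler_eq_hankelIntegral hα h1 h2 hL]
    exact (hankelIntegral_eq_of_le hL0 hφ.le
      (fun v hv => (hdiff v hv.1).differentiableWithinAt) (hint 0 hcos habs)
      (hint 0 hcos' habs')).symm
  have hK := hankelIntegral_hankelKernel h1 h2 0 (s := 1 - α) (by linarith)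
  rw [sub_sub_cancel] at hK
  have hsum : hankelIntegral 0 φ (fun v => mittagLefflerKernel α w v + w⁻¹ * hankelKernel α v) =
      hankelIntegral 0 φ (mittagLefflerKernel α w) +
        w⁻¹ * hankelIntegral 0 φ (hankelKernel α) := by
    have hvert : IntervalIntegrable
        (fun y : ℝ => mittagLefflerKernel α w ((0 : ℝ) + y * Complex.I))
        MeasureTheory.volume (-φ) φ := by
      refine ContinuousOn.intervalIntegrable fun y hy => ContinuousAt.continuousWithinAt ?_
      rw [Set.uIcc_of_le (by linarith)] at hy
      exact ContinuousAt.comp (f := fun y : ℝ => ((0 : ℝ) : ℂ) + y * Complex.I)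
        (hdiff _ (by simpa using abs_le.2 hy)).continuousAt (by fun_prop)
    have hvert' : IntervalIntegrable (fun y : ℝ => hankelKernel α ((0 : ℝ) + y * Complex.I))
        MeasureTheory.volume (-φ) φ :=
      ((differentiable_hankelKernel α).continuous.comp (by fun_prop)).intervalIntegrable _ _
    simp only [hankelIntegral]
    rw [MeasureTheory.integral_add (hint 0 hcos habs)
        ((integrableOn_hankelKernel hcos α 0).const_mul _),
      MeasureTheory.integral_add (hint 0 hcos' habs')
        ((integrableOn_hankelKernel hcos' α 0).const_mul _),
      intervalIntegral.integral_add hvert (hvert'.const_mul _),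
      MeasureTheory.integral_const_mul, MeasureTheory.integral_const_mul,
      intervalIntegral.integral_const_mul]
    ring
  have hnorm := norm_hankelIntegral_le (β := 2 * α) (C := (κ * ‖w‖ ^ 2)⁻¹) (L := 0) h1 h2
    (g := fun v => mittagLefflerKernel α w v + w⁻¹ * hankelKernel α v) fun v hv => by
      have hne := norm_pos_iff.1 (hden v hv)
      have e : mittagLefflerKernel α w v + w⁻¹ * hankelKernel α v =
          hankelKernel (2 * α) v / ((Complex.exp (α * v) - w) * w) := by
        have e2 : Complex.exp (((2 * α : ℝ) : ℂ) * v) =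
            Complex.exp (α * v) * Complex.exp (α * v) := by
          rw [← Complex.exp_add]; push_cast; ring_nf
        simp only [mittagLefflerKernel, hankelKernel, e2]
        field_simp
        ring
      rw [e, norm_div, norm_mul, div_eq_inv_mul]
      rw [show κ * ‖w‖ ^ 2 = κ * ‖w‖ * ‖w‖ by ring]
      gcongr
      exact hsep v w hv hw
  rw [hsum, hE, hK, ← hN] at hnorm
  have e : 2 * Real.pi * Complex.I * mittagLeffler α w + w⁻¹ * (2 * Real.pi * Complex.I *
      ((1 / Real.Gamma (1 - α) : ℝ) : ℂ)) = (2 * Real.pi * Complex.I) *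
      (mittagLeffler α w + ((1 / Real.Gamma (1 - α) : ℝ) : ℂ) / w) := by
    ring
  have e2 : ‖(2 * Real.pi * Complex.I : ℂ)‖ = 2 * Real.pi := by
    simp [abs_of_pos hpi]
  rw [e, norm_mul, e2] at hnorm
  rw [div_div, le_div_iff₀ (by positivity)]
  rw [inv_mul_eq_div, le_div_iff₀ (by positivity)] at hnorm
  linarith

theorem integral_pow_mul_one_sub_pow_complex (m n : ℕ) :
    ∫ s in (0 : ℝ)..1, (s : ℂ) ^ m * (1 - (s : ℂ)) ^ n =
      (m.factorial * n.factorial : ℂ) / ((m + n + 1).factorial : ℂ) := by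
  have h := Complex.Gamma_mul_Gamma_eq_betaIntegral (s := m + 1) (t := n + 1)
    (by simp; positivity) (by simp; positivity)
  have e : (m + 1 + (n + 1) : ℂ) = ((m + n + 1 : ℕ) : ℂ) + 1 := by push_cast; ring
  rw [e, Complex.Gamma_nat_eq_factorial, Complex.Gamma_nat_eq_factorial,
    Complex.Gamma_nat_eq_factorial, Complex.betaIntegral] at h
  simp only [add_sub_cancel_right, Complex.cpow_natCast] at h
  rw [h, mul_div_cancel_left₀]
  exact_mod_cast Nat.factorial_ne_zero _

theorem norm_one_sub_ofReal_le {s : ℝ} (h0 : 0 ≤ s) (h1 : s ≤ 1) : ‖(1 - (s : ℂ))‖ ≤ 1 := by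
  rw [← Complex.ofReal_one, ← Complex.ofReal_sub, Complex.norm_real,
    Real.norm_of_nonneg (by linarith)]
  linarith

open MeasureTheory Set in
theorem besselEntire_eq_one_sub_integral (m : ℕ) (q : ℂ) :
    besselEntire m q =
      1 - q * ∫ s in (0 : ℝ)..1, (s : ℂ) ^ m * besselEntire 1 (q * (1 - (s : ℂ))) := by
  have hs : HasSum (fun n : ℕ => ∫ s in (0 : ℝ)..1, (s : ℂ) ^ m *
      ((-(q * (1 - (s : ℂ)))) ^ n * (((1 : ℕ).factorial : ℂ) /
        (((1 + n).factorial : ℂ) * (n.factorial : ℂ)))))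
      (∫ s in (0 : ℝ)..1, (s : ℂ) ^ m * besselEntire 1 (q * (1 - (s : ℂ)))) := by
    refine intervalIntegral.hasSum_integral_of_dominated_convergence
      (fun n _ => ‖q‖ ^ n / n.factorial)
      (fun n => (by fun_prop : Continuous _).aestronglyMeasurable)
      (fun n => Eventually.of_forall fun s hs => ?_)
      (Eventually.of_forall fun s _ => Real.summable_pow_div_factorial _)
      intervalIntegrable_const
      (Eventually.of_forall fun s _ => (summable_besselEntire 1 _).hasSum.mul_left _)
    rw [uIoc_of_le zero_le_one] at hs
    rw [norm_mul, norm_pow, Complex.norm_real, Real.norm_of_nonneg hs.1.le]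
    refine (mul_le_of_le_one_left (norm_nonneg _) (pow_le_one₀ hs.1.le hs.2)).trans
      ((norm_besselEntire_term_le 1 n _).trans ?_)
    gcongr
    rw [norm_mul]
    exact mul_le_of_le_one_right (norm_nonneg _) (norm_one_sub_ofReal_le hs.1.le hs.2)
  have hB := (summable_besselEntire m q).tsum_eq_zero_add
  have hB0 : (-q) ^ 0 * ((m.factorial : ℂ) / (((m + 0).factorial : ℂ) * ((0 : ℕ).factorial : ℂ))) =
      1 := by
    have : (m.factorial : ℂ) ≠ 0 := by exact_mod_cast m.factorial_ne_zero
    simp [this]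
  rw [hB0] at hB
  rw [besselEntire, hB, sub_eq_add_neg, ← neg_mul, ← hs.tsum_eq, ← tsum_mul_left]
  congr 1
  refine tsum_congr fun n => ?_
  have e (s : ℝ) : (s : ℂ) ^ m * ((-(q * (1 - (s : ℂ)))) ^ n * (((1 : ℕ).factorial : ℂ) /
        (((1 + n).factorial : ℂ) * (n.factorial : ℂ)))) =
      ((-q) ^ n / (((1 + n).factorial : ℂ) * (n.factorial : ℂ))) *
        ((s : ℂ) ^ m * (1 - (s : ℂ)) ^ n) := by
    rw [← neg_mul, mul_pow]
    simp only [Nat.factorial_one, Nat.cast_one]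
    ring
  simp only [e]
  rw [intervalIntegral.integral_const_mul, integral_pow_mul_one_sub_pow_complex]
  have h1 : (n.factorial : ℂ) ≠ 0 := by exact_mod_cast n.factorial_ne_zero
  rw [show m + (n + 1) = m + n + 1 by ring, add_comm n 1]
  field_simp
  ring

open MeasureTheory Set in
theorem vekuaSeries_eq_sub_integral {α : ℝ} (hα : 0 < α) (w q : ℂ) :
    vekuaSeries α (w, q) = mittagLeffler α w -
      q * ∫ s in (0 : ℝ)..1, mittagLeffler α (w * s) * besselEntire 1 (q * (1 - (s : ℂ))) := by
  have hB : Continuous fun s : ℝ => besselEntire 1 (q * (1 - (s : ℂ))) :=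
    (differentiable_besselEntire 1).continuous.comp (by fun_prop)
  have hs : HasSum (fun m : ℕ => ∫ s in (0 : ℝ)..1,
      (w * s) ^ m / ((Real.Gamma (α * m + 1) : ℝ) : ℂ) * besselEntire 1 (q * (1 - (s : ℂ))))
      (∫ s in (0 : ℝ)..1, mittagLeffler α (w * s) * besselEntire 1 (q * (1 - (s : ℂ)))) := by
    refine intervalIntegral.hasSum_integral_of_dominated_convergence
      (fun m _ => ‖w‖ ^ m / Real.Gamma (α * m + 1) * Real.exp ‖q‖)
      (fun m => (Continuous.mul (by fun_prop) hB).aestronglyMeasurable)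
      (fun m => Eventually.of_forall fun s hs => ?_)
      (Eventually.of_forall fun s _ => (summable_pow_div_Gamma hα (norm_nonneg w)).mul_right _)
      intervalIntegrable_const
      (Eventually.of_forall fun s _ => (summable_mittagLeffler hα _).hasSum.mul_right _)
    rw [uIoc_of_le zero_le_one] at hs
    have := Gamma_mul_add_one_pos hα m
    rw [norm_mul, norm_pow_div_Gamma hα, norm_mul, Complex.norm_real, Real.norm_of_nonneg hs.1.le]
    have := hs.1.le
    gcongr
    · exact mul_le_of_le_one_right (norm_nonneg _) hs.2
    · refine (norm_besselEntire_le 1 _).trans (Real.exp_le_exp.2 ?_)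
      rw [norm_mul]
      exact mul_le_of_le_one_right (norm_nonneg _) (norm_one_sub_ofReal_le hs.1.le hs.2)
  have h := ((summable_mittagLeffler hα w).hasSum.sub (hs.mul_left q)).tsum_eq
  rw [mittagLeffler, ← h, vekuaSeries]
  refine tsum_congr fun m => ?_
  have e (s : ℝ) : (w * s) ^ m / ((Real.Gamma (α * m + 1) : ℝ) : ℂ) *
      besselEntire 1 (q * (1 - (s : ℂ))) = w ^ m / ((Real.Gamma (α * m + 1) : ℝ) : ℂ) *
        ((s : ℂ) ^ m * besselEntire 1 (q * (1 - (s : ℂ)))) := by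
    rw [mul_pow]; ring
  simp only [e]
  rw [intervalIntegral.integral_const_mul, besselEntire_eq_one_sub_integral m q]
  ring

theorem exists_norm_besselEntire_sub_le (m : ℕ) {Q : ℝ} (hQ : 0 ≤ Q) :
    ∃ K : ℝ, 0 ≤ K ∧ ∀ (q : ℂ) (s : ℝ), ‖q‖ ≤ Q → 0 ≤ s → s ≤ 1 →
      ‖besselEntire m (q * (1 - (s : ℂ))) - besselEntire m q‖ ≤ K * s := by
  obtain ⟨K, hK⟩ := (isCompact_closedBall (0 : ℂ) Q).exists_bound_of_continuousOn
    ((differentiable_besselEntire m).contDiff (n := 1)).continuous_deriv_one.continuousOn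
  have hK0 : 0 ≤ K := (norm_nonneg _).trans (hK 0 (by simpa using hQ))
  refine ⟨K * Q, by positivity, fun q s hq hs hs' => ?_⟩
  have hn := norm_one_sub_ofReal_le hs hs'
  have h := (convex_closedBall (0 : ℂ) Q).norm_image_sub_le_of_norm_deriv_le (𝕜 := ℂ)
    (f := besselEntire m) (x := q) (y := q * (1 - (s : ℂ)))
    (fun x _ => differentiable_besselEntire m x) (fun x hx => hK x hx) (by simpa using hq) (by
      rw [mem_closedBall_zero_iff, norm_mul]
      exact (mul_le_of_le_one_right (norm_nonneg _) hn).trans hq)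
  refine h.trans ?_
  rw [show q * (1 - (s : ℂ)) - q = -(q * s) by ring, norm_neg, norm_mul, Complex.norm_real,
    Real.norm_of_nonneg hs, mul_assoc]
  gcongr

open MeasureTheory Set in
/-- Uniform asymptotics of the Vekua transform, for complex values of both variables. -/
theorem exists_norm_vekuaSeries_sub_le {α c : ℝ} (hα : 0 < α) (hα' : α ≤ 1)
    (hc : c < Real.cos (Real.pi * α / 2)) {r R Q : ℝ} (hr : 0 < r) (hQ : 0 ≤ Q) :
    ∃ C : ℝ, 0 ≤ C ∧ ∀ (τ : ℝ) (z q : ℂ), 1 ≤ τ → z.re ≤ c * ‖z‖ → r ≤ ‖z‖ → ‖z‖ ≤ R → ‖q‖ ≤ Q →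
      ‖vekuaSeries α (τ * z, q) - q * besselEntire 1 q / z *
        ((1 / Real.Gamma (1 - α) * (Real.log τ / τ) : ℝ) : ℂ)‖ ≤ C / τ := by
  obtain ⟨M, hM0, hM⟩ := exists_norm_mittagLeffler_add_le hα hα' hc
  obtain ⟨M₀, hM₀0, hM₀⟩ := exists_norm_mittagLeffler_le hα R
  obtain ⟨K, hK0, hK⟩ := exists_norm_besselEntire_sub_le 1 hQ
  set a : ℝ := 1 / Real.Gamma (1 - α) with ha
  set D : ℝ := M * Real.exp Q / r ^ 2 + |a| * K / r with hD
  refine ⟨|a| / r + M / r ^ 2 + Q * (M₀ * Real.exp Q + D), by positivity,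
    fun τ z q hτ hz hrz hzR hq => ?_⟩
  have hτ0 : 0 < τ := by linarith
  have hz0 : 0 < ‖z‖ := hr.trans_le hrz
  have hzne : z ≠ 0 := norm_pos_iff.1 hz0
  have hτinv : τ⁻¹ ≤ 1 := inv_le_one_of_one_le₀ hτ
  have hτne : (τ : ℂ) ≠ 0 := by exact_mod_cast hτ0.ne'
  have norm_arg (s : ℝ) (hs : 0 < s) : ‖(τ : ℂ) * z * s‖ = τ * ‖z‖ * s := by
    rw [norm_mul, norm_mul, Complex.norm_real, Complex.norm_real, Real.norm_of_nonneg hτ0.le,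
      Real.norm_of_nonneg hs.le]
  have asymp (s : ℝ) (hs : 0 < s) :
      ‖mittagLeffler α (τ * z * s) + (a : ℂ) / (τ * z * s)‖ ≤ M / r ^ 2 / τ ^ 2 * (s ^ 2)⁻¹ := by
    have hsne : (s : ℂ) ≠ 0 := by exact_mod_cast hs.ne'
    refine (hM _ (by simp [hτne, hzne, hsne]) ?_).trans ?_
    · rw [norm_arg s hs, show (τ : ℂ) * z * s = ((τ * s : ℝ) : ℂ) * z by push_cast; ring,
        Complex.re_ofReal_mul]
      calc τ * s * z.re ≤ τ * s * (c * ‖z‖) := by gcongr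
        _ = _ := by ring
    · rw [norm_arg s hs]
      calc M / (τ * ‖z‖ * s) ^ 2 ≤ M / (τ * r * s) ^ 2 := by gcongr
        _ = _ := by field_simp
  have hBnorm (s : ℝ) (h0 : 0 ≤ s) (h1 : s ≤ 1) :
      ‖besselEntire 1 (q * (1 - (s : ℂ)))‖ ≤ Real.exp Q := by
    refine (norm_besselEntire_le 1 _).trans (Real.exp_le_exp.2 ?_)
    rw [norm_mul]
    exact (mul_le_of_le_one_right (norm_nonneg _) (norm_one_sub_ofReal_le h0 h1)).trans hq
  have b1 : ‖mittagLeffler α (τ * z)‖ ≤ (|a| / r + M / r ^ 2) / τ := by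
    have h := asymp 1 one_pos
    simp only [Complex.ofReal_one, mul_one, one_pow, inv_one] at h
    have h2 : ‖(a : ℂ) / (τ * z)‖ ≤ |a| / r / τ := by
      rw [norm_div, norm_mul, Complex.norm_real, Complex.norm_real, Real.norm_of_nonneg hτ0.le,
        Real.norm_eq_abs, div_div, mul_comm r]
      gcongr
    have h3 : M / r ^ 2 / τ ^ 2 ≤ M / r ^ 2 / τ := by
      gcongr
      nlinarith
    have h4 := norm_sub_le (mittagLeffler α (τ * z) + (a : ℂ) / (τ * z)) ((a : ℂ) / (τ * z))
    rw [add_sub_cancel_right] at h4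
    rw [add_div]
    linarith
  set G : ℝ → ℂ := fun s => mittagLeffler α (τ * z * s) * besselEntire 1 (q * (1 - (s : ℂ)))
    with hG
  have hGc : Continuous G :=
    ((differentiable_mittagLeffler hα).continuous.comp (by fun_prop)).mul
      ((differentiable_besselEntire 1).continuous.comp (by fun_prop))
  have b2 : ‖∫ s in (0 : ℝ)..τ⁻¹, G s‖ ≤ M₀ * Real.exp Q / τ := by
    have h := intervalIntegral.norm_integral_le_of_norm_le_const (a := 0) (b := τ⁻¹) (f := G)
      (C := M₀ * Real.exp Q) fun s hs => by
        rw [uIoc_of_le (by positivity)] at hs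
        rw [hG, norm_mul]
        gcongr
        · refine hM₀ _ ?_
          rw [norm_arg s hs.1]
          calc τ * ‖z‖ * s ≤ τ * ‖z‖ * τ⁻¹ := by gcongr; exact hs.2
            _ = ‖z‖ := by field_simp
            _ ≤ R := hzR
        · exact hBnorm s hs.1.le (hs.2.trans hτinv)
    rwa [sub_zero, abs_of_pos (by positivity), ← div_eq_mul_inv] at h
  have hmem {s : ℝ} (hs : s ∈ uIcc τ⁻¹ 1) : 0 < s := by
    rw [uIcc_of_le hτinv] at hs
    exact (inv_pos.2 hτ0).trans_le hs.1
  have hlog : ∫ s in τ⁻¹..1, (a : ℂ) * besselEntire 1 q / (τ * z) * ((s⁻¹ : ℝ) : ℂ) =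
      besselEntire 1 q / z * ((a * (Real.log τ / τ) : ℝ) : ℂ) := by
    rw [intervalIntegral.integral_const_mul, intervalIntegral.integral_ofReal,
      integral_inv_of_pos (by positivity) one_pos, one_div, inv_inv]
    push_cast
    field_simp
  have hinv : IntervalIntegrable (fun s : ℝ => (a : ℂ) * besselEntire 1 q / (τ * z) *
      ((s⁻¹ : ℝ) : ℂ)) volume τ⁻¹ 1 := by
    refine ContinuousOn.intervalIntegrable (continuousOn_const.mul ?_)
    exact Complex.continuous_ofReal.comp_continuousOn
      (continuousOn_inv₀.mono fun s hs => (hmem hs).ne')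
  have b3 : ‖∫ s in τ⁻¹..1, (G s + (a : ℂ) * besselEntire 1 q / (τ * z) * ((s⁻¹ : ℝ) : ℂ))‖ ≤
      D / τ := by
    set A : ℝ := M * Real.exp Q / r ^ 2 / τ ^ 2 with hA
    set B : ℝ := |a| * K / r / τ with hB
    have hcont : ContinuousOn (fun s : ℝ => A * s ^ (-2 : ℤ) + B) (uIcc τ⁻¹ 1) := fun s hs =>
      (continuousAt_const.mul (continuousAt_zpow₀ _ _ (Or.inl (hmem hs).ne')) |>.add
        continuousAt_const).continuousWithinAt
    have h := intervalIntegral.norm_integral_le_of_norm_le (μ := volume) hτinv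
      (g := fun s : ℝ => A * s ^ (-2 : ℤ) + B)
      (f := fun s => G s + (a : ℂ) * besselEntire 1 q / (τ * z) * ((s⁻¹ : ℝ) : ℂ))
      (Eventually.of_forall fun s hs => ?_) hcont.intervalIntegrable
    · refine h.trans ?_
      have hz : ContinuousOn (fun s : ℝ => s ^ (-2 : ℤ)) (uIcc τ⁻¹ 1) := fun s hs =>
        (continuousAt_zpow₀ _ _ (Or.inl (hmem hs).ne')).continuousWithinAt
      rw [intervalIntegral.integral_add (hz.intervalIntegrable.const_mul A)
        intervalIntegrable_const, intervalIntegral.integral_const_mul,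
        integral_zpow (Or.inr ⟨by norm_num, fun h0 => (hmem h0).false⟩),
        intervalIntegral.integral_const]
      norm_num
      have hA0 : 0 ≤ A := by positivity
      have hB0 : 0 ≤ B := by positivity
      have hDe : D / τ = A * τ + B := by
        rw [hD, hA, hB]
        field_simp
      rw [hDe]
      have := inv_pos.2 hτ0
      nlinarith
    · have hs0 : 0 < s := (inv_pos.2 hτ0).trans hs.1
      have hsne : (s : ℂ) ≠ 0 := by exact_mod_cast hs0.ne'
      have e : G s + (a : ℂ) * besselEntire 1 q / (τ * z) * ((s⁻¹ : ℝ) : ℂ) =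
          (mittagLeffler α (τ * z * s) + (a : ℂ) / (τ * z * s)) *
            besselEntire 1 (q * (1 - (s : ℂ))) -
          (a : ℂ) / (τ * z * s) * (besselEntire 1 (q * (1 - (s : ℂ))) - besselEntire 1 q) := by
        rw [hG]
        push_cast
        field_simp
        ring
      rw [e]
      refine (norm_sub_le _ _).trans (add_le_add ?_ ?_)
      · rw [norm_mul]
        calc _ ≤ M / r ^ 2 / τ ^ 2 * (s ^ 2)⁻¹ * Real.exp Q := by
              gcongr
              · exact asymp s hs0
              · exact hBnorm s hs0.le hs.2
          _ = A * s ^ (-2 : ℤ) := by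
              rw [hA, zpow_neg]
              norm_cast
              ring
      · rw [norm_mul, norm_div, norm_arg s hs0, Complex.norm_real, Real.norm_eq_abs]
        calc _ ≤ |a| / (τ * r * s) * (K * s) := by
              gcongr
              exact hK q s hq hs0.le hs.2
          _ = B := by
              rw [hB]
              field_simp
  have hsplit : (∫ s in (0 : ℝ)..1, G s) + besselEntire 1 q / z * ((a * (Real.log τ / τ) : ℝ) : ℂ) =
      (∫ s in (0 : ℝ)..τ⁻¹, G s) +
      ∫ s in τ⁻¹..1, (G s + (a : ℂ) * besselEntire 1 q / (τ * z) * ((s⁻¹ : ℝ) : ℂ)) := by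
    rw [intervalIntegral.integral_add (hGc.intervalIntegrable _ _) hinv, hlog,
      ← intervalIntegral.integral_add_adjacent_intervals (hGc.intervalIntegrable 0 τ⁻¹)
        (hGc.intervalIntegrable τ⁻¹ 1)]
    ring
  have e : vekuaSeries α (τ * z, q) - q * besselEntire 1 q / z *
        ((a * (Real.log τ / τ) : ℝ) : ℂ) = mittagLeffler α (τ * z) -
      q * ((∫ s in (0 : ℝ)..τ⁻¹, G s) +
      ∫ s in τ⁻¹..1, (G s + (a : ℂ) * besselEntire 1 q / (τ * z) * ((s⁻¹ : ℝ) : ℂ))) := by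
    rw [vekuaSeries_eq_sub_integral hα, ← hsplit]
    ring
  rw [e]
  calc _ ≤ (|a| / r + M / r ^ 2) / τ + Q * (M₀ * Real.exp Q / τ + D / τ) := by
        refine (norm_sub_le _ _).trans (add_le_add b1 ?_)
        rw [norm_mul]
        gcongr
        exact (norm_add_le _ _).trans (add_le_add b2 b3)
    _ = _ := by ring

theorem toComplex_re (x : Plane) : (toComplex x).re = x 0 := by simp [toComplex]

theorem norm_sq_plane (x : Plane) : ‖x‖ ^ 2 = x 0 ^ 2 + x 1 ^ 2 := by
  simp [EuclideanSpace.norm_sq_eq]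

theorem norm_toComplex (x : Plane) : ‖toComplex x‖ = ‖x‖ := by
  rw [← sq_eq_sq₀ (norm_nonneg _) (norm_nonneg _), norm_sq_plane, Complex.sq_norm,
    Complex.normSq_apply]
  simp [toComplex]
  ring

theorem toComplex_ne_zero {x : Plane} (hx : x ≠ 0) : toComplex x ≠ 0 := by
  rwa [← norm_pos_iff, norm_toComplex, norm_pos_iff]

theorem toComplex_add_smul (x u : Plane) (t : ℝ) :
    toComplex (x + t • u) = toComplex x + t * toComplex u := by
  simp [toComplex]
  ring

theorem ofReal_sq_mul_norm (k : ℝ) (x : Plane) :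
    (((k * ‖x‖ / 2) ^ 2 : ℝ) : ℂ) = (k / 2 : ℂ) ^ 2 * ((x 0 : ℂ) ^ 2 + (x 1 : ℂ) ^ 2) := by
  rw [show (k * ‖x‖ / 2) ^ 2 = (k / 2) ^ 2 * ‖x‖ ^ 2 by ring, norm_sq_plane]
  push_cast
  ring

theorem mem_cone_iff (x : Plane) (θ : ℝ) : x ∈ cone θ ↔ ‖x‖ * Real.cos θ < x 0 := by
  simp [cone, openCone, EuclideanSpace.inner_single_right]

theorem lt_of_notMem_closure_cone {x : Plane} {θ : ℝ} (h0 : 0 < θ) (h1 : θ ≤ Real.pi / 2)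
    (hx : x ∉ closure (cone θ)) : x 0 < ‖x‖ * Real.cos θ := by
  by_contra! hle
  refine hx ?_
  have hκ0 : 0 ≤ Real.cos θ := Real.cos_nonneg_of_neg_pi_div_two_le_of_le (by linarith) h1
  have hκ1 : Real.cos θ < 1 := by
    rw [← Real.cos_zero]
    exact Real.cos_lt_cos_of_nonneg_of_le_pi_div_two le_rfl h1 h0
  have ht : Tendsto (fun t : ℝ => x + t • (EuclideanSpace.single 0 1 : Plane))
      (nhdsWithin 0 (Set.Ioi 0)) (nhds x) := by
    have : Continuous fun t : ℝ => x + t • (EuclideanSpace.single 0 1 : Plane) := by fun_prop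
    have h := (this.tendsto 0).mono_left (nhdsWithin_le_nhds (s := Set.Ioi 0))
    simpa using h
  refine mem_closure_of_tendsto ht ?_
  filter_upwards [self_mem_nhdsWithin] with t ht0
  have ht0 : 0 < t := ht0
  rw [mem_cone_iff]
  have e0 : (x + t • (EuclideanSpace.single 0 1 : Plane)) 0 = x 0 + t := by simp
  have e1 : (x + t • (EuclideanSpace.single 0 1 : Plane)) 1 = x 1 := by simp
  have hx0 : 0 ≤ x 0 := (mul_nonneg (norm_nonneg _) hκ0).trans hle
  rw [e0]
  refine lt_of_pow_lt_pow_left₀ 2 (by linarith) ?_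
  rw [mul_pow, norm_sq_plane, e0, e1]
  have h2 : (x 0 ^ 2 + x 1 ^ 2) * Real.cos θ ^ 2 ≤ x 0 ^ 2 := by
    rw [← norm_sq_plane, ← mul_pow]
    gcongr
  have h3 : Real.cos θ ^ 2 < 1 := by nlinarith
  have h4 : 0 < (2 * t * x 0 + t ^ 2) * (1 - Real.cos θ ^ 2) :=
    mul_pos (by positivity) (by linarith)
  nlinarith

theorem notMem_closure_cone_of_lt {x : Plane} {θ : ℝ} (h : x 0 < ‖x‖ * Real.cos θ) :
    x ∉ closure (cone θ) := by
  intro hx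
  have hsub : closure (cone θ) ⊆ {y : Plane | ‖y‖ * Real.cos θ ≤ y 0} := by
    refine closure_minimal (fun y hy => ((mem_cone_iff y θ).1 hy).le) ?_
    exact isClosed_le (by fun_prop) (by fun_prop)
  exact not_le.2 h (hsub hx)

theorem differentiable_ofReal_coord (i : Fin 2) :
    Differentiable ℝ fun y : Plane => ((y i : ℝ) : ℂ) :=
  (Complex.ofRealCLM.comp (EuclideanSpace.proj i : Plane →L[ℝ] ℝ)).differentiable

theorem differentiable_toComplex : Differentiable ℝ toComplex :=
  (differentiable_ofReal_coord 0).add ((differentiable_ofReal_coord 1).const_mul _)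

theorem differentiable_ofReal_sq_mul_norm (k : ℝ) :
    Differentiable ℝ fun y : Plane => (((k * ‖y‖ / 2) ^ 2 : ℝ) : ℂ) := by
  simp only [ofReal_sq_mul_norm]
  exact (((differentiable_ofReal_coord 0).pow 2).add
    ((differentiable_ofReal_coord 1).pow 2)).const_mul _

theorem differentiable_mittagLefflerVekua {α : ℝ} (hα : 0 < α) (k τ : ℝ) :
    Differentiable ℝ fun y : Plane => mittagLefflerVekua α k y τ := by
  simp only [mittagLefflerVekua_eq]
  exact ((differentiable_vekuaSeries hα).restrictScalars ℝ).comp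
    ((differentiable_toComplex.const_mul _).prodMk (differentiable_ofReal_sq_mul_norm k))

theorem differentiableAt_besselFactor (k : ℝ) {x : Plane} (hx : x ≠ 0) :
    DifferentiableAt ℝ (besselFactor k) x := by
  have e : besselFactor k = fun y => (((k * ‖y‖ / 2) ^ 2 : ℝ) : ℂ) *
      besselEntire 1 (((k * ‖y‖ / 2) ^ 2 : ℝ) : ℂ) * (toComplex y)⁻¹ := by
    funext y
    rw [besselFactor_eq, div_eq_mul_inv]
  have hq := differentiable_ofReal_sq_mul_norm k
  rw [e]
  exact ((hq x).mul ((((differentiable_besselEntire 1).restrictScalars ℝ).comp hq) x)).mul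
    ((differentiable_toComplex x).inv (toComplex_ne_zero hx))

/-- The difference of the two sides of the asymptotic formula, as a function of `z = x₁ + ix₂`
and `q = (k|x|/2)²`. -/
noncomputable def vekuaRemainder (α τ : ℝ) (z q : ℂ) : ℂ :=
  vekuaSeries α (τ * z, q) - q * besselEntire 1 q / z *
    ((1 / Real.Gamma (1 - α) * (Real.log τ / τ) : ℝ) : ℂ)

theorem mittagLefflerVekua_sub_eq (α k τ : ℝ) (x : Plane) :
    mittagLefflerVekua α k x τ -
        besselFactor k x * ((1 / Real.Gamma (1 - α) * (Real.log τ / τ) : ℝ) : ℂ) =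
      vekuaRemainder α τ (toComplex x) (((k * ‖x‖ / 2) ^ 2 : ℝ) : ℂ) := by
  rw [mittagLefflerVekua_eq, besselFactor_eq, vekuaRemainder]

/-- The complexification of `t ↦ (k|x + tu|/2)²`. -/
noncomputable def complexSqNorm (k : ℝ) (x u : Plane) (h : ℂ) : ℂ :=
  (k / 2 : ℂ) ^ 2 * (((x 0 : ℂ) + h * (u 0 : ℂ)) ^ 2 + ((x 1 : ℂ) + h * (u 1 : ℂ)) ^ 2)

theorem complexSqNorm_ofReal (k : ℝ) (x u : Plane) (t : ℝ) :
    complexSqNorm k x u t = (((k * ‖x + t • u‖ / 2) ^ 2 : ℝ) : ℂ) := by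
  rw [ofReal_sq_mul_norm, complexSqNorm]
  simp

theorem abs_coord_le_norm (x : Plane) (i : Fin 2) : |x i| ≤ ‖x‖ := by
  simpa using PiLp.norm_apply_le x i

theorem norm_complexSqNorm_le (k : ℝ) {x u : Plane} {R : ℝ} {h : ℂ} (hx : ‖x‖ ≤ R)
    (hu : ‖u‖ ≤ 1) (hh : ‖h‖ ≤ 1) :
    ‖complexSqNorm k x u h‖ ≤ (k / 2) ^ 2 * (2 * (R + 1) ^ 2) := by
  have hi (i : Fin 2) : ‖(x i : ℂ) + h * (u i : ℂ)‖ ≤ R + 1 := by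
    refine (norm_add_le _ _).trans (add_le_add ?_ ?_)
    · rw [Complex.norm_real]
      exact (abs_coord_le_norm x i).trans hx
    · rw [norm_mul, Complex.norm_real]
      exact mul_le_one₀ hh (norm_nonneg _) ((abs_coord_le_norm u i).trans hu)
  rw [complexSqNorm, norm_mul, norm_pow]
  have hk : ‖(k / 2 : ℂ)‖ ^ 2 = (k / 2) ^ 2 := by
    rw [← Complex.ofReal_ofNat, ← Complex.ofReal_div, Complex.norm_real, Real.norm_eq_abs, sq_abs]
  rw [hk]
  refine mul_le_mul_of_nonneg_left ((norm_add_le _ _).trans ?_) (sq_nonneg _)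
  rw [norm_pow, norm_pow, two_mul]
  exact add_le_add (pow_le_pow_left₀ (norm_nonneg _) (hi 0) 2)
    (pow_le_pow_left₀ (norm_nonneg _) (hi 1) 2)

theorem fderiv_eq_deriv_of_complexification {F : Plane → ℂ} {x u : Plane} {g : ℂ → ℂ}
    (hF : DifferentiableAt ℝ F x) (hg : DifferentiableAt ℂ g 0)
    (h : ∀ t : ℝ, F (x + t • u) = g t) : fderiv ℝ F x u = deriv g 0 := by
  have hline : HasDerivAt (fun t : ℝ => x + t • u) u 0 := by
    simpa using ((hasDerivAt_id (0 : ℝ)).smul_const u).const_add x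
  have h1 : HasDerivAt (fun t : ℝ => F (x + t • u)) (fderiv ℝ F x u) 0 := by
    refine HasFDerivAt.comp_hasDerivAt (f := fun t : ℝ => x + t • u) 0 ?_ hline
    simpa using hF.hasFDerivAt
  have h2 : HasDerivAt (fun t : ℝ => g t) (deriv g 0) 0 := by
    have : HasDerivAt g (deriv g 0) ((0 : ℝ) : ℂ) := by simpa using hg.hasDerivAt
    exact this.comp_ofReal
  simp only [h] at h1
  exact h1.unique h2

theorem re_add_le_mul_norm_add {z w : ℂ} {c c' : ℝ} (hz : z.re ≤ c * ‖z‖) (hc' : |c'| ≤ 1)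
    (hw : 2 * ‖w‖ ≤ (c' - c) * ‖z‖) : (z + w).re ≤ c' * ‖z + w‖ := by
  have h1 : w.re ≤ ‖w‖ := Complex.re_le_norm w
  have h2 : |‖z + w‖ - ‖z‖| ≤ ‖w‖ := by
    have := abs_norm_sub_norm_le (z + w) z
    rwa [add_sub_cancel_left] at this
  have h3 : |c' * (‖z + w‖ - ‖z‖)| ≤ ‖w‖ := by
    rw [abs_mul]
    exact (mul_le_of_le_one_left (abs_nonneg _) hc').trans h2
  have h4 := (abs_le.1 h3).1
  rw [Complex.add_re]
  linarith

theorem exists_uniform_bound {α k : ℝ} (hα : 0 < α) (hα' : α ≤ 1) {c R : ℝ} (hc1 : -1 ≤ c)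
    (hc : c < Real.cos (Real.pi * α / 2)) (hR : 0 < R) :
    ∃ C : ℝ, ∀ τ : ℝ, 1 ≤ τ → ∀ x : Plane, x 0 ≤ c * ‖x‖ → R⁻¹ < ‖x‖ → ‖x‖ < R →
      ‖mittagLefflerVekua α k x τ -
        besselFactor k x * ((1 / Real.Gamma (1 - α) * (Real.log τ / τ) : ℝ) : ℂ)‖ ≤ C / τ ∧
      ∀ j : Fin 2,
        ‖partialDeriv j (fun y : Plane => mittagLefflerVekua α k y τ) x -
          partialDeriv j (besselFactor k) x *
            ((1 / Real.Gamma (1 - α) * (Real.log τ / τ) : ℝ) : ℂ)‖ ≤ C / τ := by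
  set κ := Real.cos (Real.pi * α / 2) with hκ
  have hκ1 : κ ≤ 1 := Real.cos_le_one _
  set c' := (c + κ) / 2 with hc'
  have hc'1 : |c'| ≤ 1 := abs_le.2 ⟨by linarith, by linarith⟩
  have hR' : 0 < R⁻¹ := inv_pos.2 hR
  set ρ := min 1 (R⁻¹ * (κ - c) / 4) with hρ
  have hρ0 : 0 < ρ := lt_min one_pos (by
    have : 0 < κ - c := by linarith
    positivity)
  have hρ1 : ρ ≤ 1 := min_le_left _ _
  have hρ2 : ρ ≤ R⁻¹ * (κ - c) / 4 := min_le_right _ _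
  have hρ3 : ρ ≤ R⁻¹ / 2 := hρ2.trans (by nlinarith)
  obtain ⟨C, hC0, hC⟩ := exists_norm_vekuaSeries_sub_le (r := R⁻¹ / 2) (R := R + 1)
    (Q := (k / 2) ^ 2 * (2 * (R + 1) ^ 2)) hα hα' (show c' < κ by linarith) (by positivity)
    (by positivity)
  refine ⟨max C (C / ρ), fun τ hτ x hxc hxR hxR' => ?_⟩
  have hτ0 : 0 < τ := by linarith
  have hx0 : x ≠ 0 := norm_pos_iff.1 (hR'.trans hxR)
  set g : Plane → ℂ → ℂ := fun u h =>
    vekuaRemainder α τ (toComplex x + h * toComplex u) (complexSqNorm k x u h) with hg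
  have hnear {u : Plane} (hu : ‖u‖ = 1) {h : ℂ} (hh : ‖h‖ ≤ ρ) :
      R⁻¹ / 2 ≤ ‖toComplex x + h * toComplex u‖ ∧ ‖toComplex x + h * toComplex u‖ ≤ R + 1 ∧
      (toComplex x + h * toComplex u).re ≤ c' * ‖toComplex x + h * toComplex u‖ := by
    have hw : ‖h * toComplex u‖ ≤ ρ := by rwa [norm_mul, norm_toComplex, hu, mul_one]
    have h1 := norm_add_le (toComplex x) (h * toComplex u)
    have h2 := norm_sub_le (toComplex x + h * toComplex u) (h * toComplex u)
    rw [add_sub_cancel_right] at h2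
    rw [norm_toComplex] at h1 h2
    refine ⟨by linarith, by linarith, re_add_le_mul_norm_add (c := c) ?_ hc'1 ?_⟩
    · rwa [toComplex_re, norm_toComplex]
    · rw [norm_toComplex]
      nlinarith
  have hgle {u : Plane} (hu : ‖u‖ = 1) {h : ℂ} (hh : ‖h‖ ≤ ρ) : ‖g u h‖ ≤ C / τ := by
    obtain ⟨h1, h2, h3⟩ := hnear hu hh
    exact hC τ _ _ hτ h3 h1 h2 (norm_complexSqNorm_le k hxR'.le hu.le (hh.trans hρ1))
  have hgd {u : Plane} (hu : ‖u‖ = 1) {h : ℂ} (hh : ‖h‖ ≤ ρ) : DifferentiableAt ℂ (g u) h := by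
    have hne : toComplex x + h * toComplex u ≠ 0 :=
      norm_pos_iff.1 ((by positivity : 0 < R⁻¹ / 2).trans_le (hnear hu hh).1)
    have hz : Differentiable ℂ fun h : ℂ => toComplex x + h * toComplex u := by fun_prop
    have hq : Differentiable ℂ (complexSqNorm k x u) := by
      unfold complexSqNorm
      fun_prop
    have hB := (differentiable_besselEntire 1).comp hq
    have hf := (differentiable_vekuaSeries hα).comp ((hz.const_mul (τ : ℂ)).prodMk hq)
    exact (hf h).sub ((((hq h).mul (hB h)).div (hz h) hne).mul_const _)
  have hremainder (u : Plane) (t : ℝ) : mittagLefflerVekua α k (x + t • u) τ -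
      besselFactor k (x + t • u) *
        ((1 / Real.Gamma (1 - α) * (Real.log τ / τ) : ℝ) : ℂ) = g u t := by
    rw [mittagLefflerVekua_sub_eq, ← complexSqNorm_ofReal, toComplex_add_smul]
  have hsingle (j : Fin 2) : ‖(EuclideanSpace.single j 1 : Plane)‖ = 1 := by simp
  refine ⟨?_, fun j => ?_⟩
  · have h := hremainder (EuclideanSpace.single 0 1) 0
    rw [zero_smul, add_zero] at h
    rw [h]
    exact (hgle (hsingle 0) (by simpa using hρ0.le)).trans (by gcongr; exact le_max_left _ _)
  · set u : Plane := EuclideanSpace.single j 1 with hu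
    have hu1 : ‖u‖ = 1 := hsingle j
    have hE := differentiable_mittagLefflerVekua hα k τ x
    have hb := differentiableAt_besselFactor k hx0
    have hd := fderiv_eq_deriv_of_complexification
      (hE.sub (hb.mul_const ((1 / Real.Gamma (1 - α) * (Real.log τ / τ) : ℝ) : ℂ)))
      (hgd hu1 (by simpa using hρ0.le)) (hremainder u)
    have hsub : fderiv ℝ ((fun y : Plane => mittagLefflerVekua α k y τ) - fun y : Plane =>
        besselFactor k y * ((1 / Real.Gamma (1 - α) * (Real.log τ / τ) : ℝ) : ℂ)) x u =
        partialDeriv j (fun y : Plane => mittagLefflerVekua α k y τ) x -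
          partialDeriv j (besselFactor k) x *
            ((1 / Real.Gamma (1 - α) * (Real.log τ / τ) : ℝ) : ℂ) := by
      rw [fderiv_sub hE (hb.mul_const _), fderiv_mul_const hb]
      simp [partialDeriv, hu, mul_comm]
    rw [← hsub, hd]
    refine (Complex.norm_deriv_le_of_forall_mem_sphere_norm_le (C := C / τ) hρ0
      (DifferentiableOn.diffContOnCl fun h hh => ?_) fun h hh => ?_).trans ?_
    · rw [closure_ball _ hρ0.ne', mem_closedBall_zero_iff] at hh
      exact (hgd hu1 hh).differentiableWithinAt
    · exact hgle hu1 (mem_sphere_zero_iff_norm.1 hh).le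
    · rw [div_right_comm]
      gcongr
      exact le_max_right _ _

theorem exists_notMem_closure_cone_add {x : Plane} {θ : ℝ} (h0 : 0 < θ) (h1 : θ ≤ Real.pi / 2)
    (hx : x ∉ closure (cone θ)) :
    ∃ ε : ℝ, 0 < ε ∧ ε < Real.pi - θ ∧ x ∉ closure (cone (θ + ε)) := by
  have hlt := lt_of_notMem_closure_cone h0 h1 hx
  have hcont : Continuous fun ε : ℝ => ‖x‖ * Real.cos (θ + ε) := by fun_prop
  have ht := (hcont.tendsto 0).mono_left (nhdsWithin_le_nhds (s := Set.Ioi 0))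
  rw [add_zero] at ht
  have hpos : 0 < Real.pi - θ := by linarith [Real.pi_pos]
  obtain ⟨ε, hε, hε'⟩ := ((ht.eventually_const_lt hlt).and (Ioo_mem_nhdsGT hpos)).exists
  exact ⟨ε, hε'.1, hε'.2, notMem_closure_cone_of_lt hε⟩

theorem tendsto_zero_of_isBigO_sub_log {f : ℝ → ℂ} {b : ℂ} {a : ℝ}
    (h : (fun τ : ℝ => f τ - b * ((a * (Real.log τ / τ) : ℝ) : ℂ)) =O[atTop]
      (fun τ : ℝ => 1 / τ)) : Tendsto f atTop (nhds 0) := by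
  have h1 : Tendsto (fun τ : ℝ => 1 / τ) atTop (nhds 0) := by
    simpa using tendsto_inv_atTop_zero (𝕜 := ℝ)
  have h2 : Tendsto (fun τ : ℝ => b * ((a * (Real.log τ / τ) : ℝ) : ℂ)) atTop (nhds 0) := by
    have hl : Tendsto (fun τ : ℝ => Real.log τ / τ) atTop (nhds 0) :=
      Real.isLittleO_log_id_atTop.tendsto_div_nhds_zero
    have := ((Complex.continuous_ofReal.tendsto _).comp (hl.const_mul a)).const_mul b
    simpa using this
  have := (h.trans_tendsto h1).add h2
  simpa using this

theorem proposition2p1 (α k : ℝ) (hα_pos : 0 < α) (hα_le : α ≤ 1) (hk : 0 ≤ k) :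
    (∀ x : Plane, x ∉ closure (cone (Real.pi * α / 2)) →
      DifferentiableAt ℝ (besselFactor k) x ∧
      (∀ τ : ℝ, 0 < τ → DifferentiableAt ℝ (fun y : Plane => mittagLefflerVekua α k y τ) x) ∧
      ((fun τ : ℝ => mittagLefflerVekua α k x τ -
          besselFactor k x * ((1 / Real.Gamma (1 - α) * (Real.log τ / τ) : ℝ) : ℂ))
        =O[atTop] (fun τ : ℝ => 1 / τ)) ∧
      (∀ j : Fin 2,
        (fun τ : ℝ => partialDeriv j (fun y : Plane => mittagLefflerVekua α k y τ) x -
          partialDeriv j (besselFactor k) x *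
            ((1 / Real.Gamma (1 - α) * (Real.log τ / τ) : ℝ) : ℂ))
        =O[atTop] (fun τ : ℝ => 1 / τ)) ∧
      Tendsto (fun τ : ℝ => mittagLefflerVekua α k x τ) atTop (nhds 0)) ∧
    (∀ ε R : ℝ, 0 < ε → ε < Real.pi - Real.pi * α / 2 → 0 < R →
      ∃ C τ₀ : ℝ, 0 < τ₀ ∧ ∀ τ : ℝ, τ₀ ≤ τ → ∀ x : Plane,
        x ∉ closure (cone (Real.pi * α / 2 + ε)) → R⁻¹ < ‖x‖ → ‖x‖ < R →
          ‖mittagLefflerVekua α k x τ -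
            besselFactor k x * ((1 / Real.Gamma (1 - α) * (Real.log τ / τ) : ℝ) : ℂ)‖ ≤ C / τ ∧
          ∀ j : Fin 2,
            ‖partialDeriv j (fun y : Plane => mittagLefflerVekua α k y τ) x -
              partialDeriv j (besselFactor k) x *
                ((1 / Real.Gamma (1 - α) * (Real.log τ / τ) : ℝ) : ℂ)‖ ≤ C / τ) := by
  have hpi := Real.pi_pos
  have hθ0 : 0 < Real.pi * α / 2 := by positivity
  have hθ1 : Real.pi * α / 2 ≤ Real.pi / 2 := by nlinarith
  have huniform : ∀ ε R : ℝ, 0 < ε → ε < Real.pi - Real.pi * α / 2 → 0 < R →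
      ∃ C τ₀ : ℝ, 0 < τ₀ ∧ ∀ τ : ℝ, τ₀ ≤ τ → ∀ x : Plane,
        x ∉ closure (cone (Real.pi * α / 2 + ε)) → R⁻¹ < ‖x‖ → ‖x‖ < R →
          ‖mittagLefflerVekua α k x τ -
            besselFactor k x * ((1 / Real.Gamma (1 - α) * (Real.log τ / τ) : ℝ) : ℂ)‖ ≤ C / τ ∧
          ∀ j : Fin 2,
            ‖partialDeriv j (fun y : Plane => mittagLefflerVekua α k y τ) x -
              partialDeriv j (besselFactor k) x *
                ((1 / Real.Gamma (1 - α) * (Real.log τ / τ) : ℝ) : ℂ)‖ ≤ C / τ := by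
    intro ε R hε hε' hR
    obtain ⟨C, hC⟩ := exists_uniform_bound (k := k) hα_pos hα_le
      (c := Real.cos (Real.pi * α / 2 + ε)) (Real.neg_one_le_cos _)
      (Real.cos_lt_cos_of_nonneg_of_le_pi hθ0.le (by linarith) (by linarith)) hR
    refine ⟨C, 1, one_pos, fun τ hτ x hx => hC τ hτ x ?_⟩
    have := fun h => hx (subset_closure ((mem_cone_iff x _).2 h))
    rw [mul_comm]
    exact not_lt.1 this
  refine ⟨fun x hx => ?_, huniform⟩
  have hx0 : x ≠ 0 := by
    rintro rfl
    simpa using lt_of_notMem_closure_cone hθ0 hθ1 hx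
  have hxpos : 0 < ‖x‖ := norm_pos_iff.2 hx0
  obtain ⟨ε, hε, hε', hxε⟩ := exists_notMem_closure_cone_add hθ0 hθ1 hx
  obtain ⟨C, τ₀, hτ₀, hC⟩ := huniform ε (‖x‖ + ‖x‖⁻¹) hε hε' (by positivity)
  have hR1 : (‖x‖ + ‖x‖⁻¹)⁻¹ < ‖x‖ :=
    inv_lt_of_inv_lt₀ hxpos (lt_add_of_pos_left _ hxpos)
  have hR2 : ‖x‖ < ‖x‖ + ‖x‖⁻¹ := lt_add_of_pos_right _ (inv_pos.2 hxpos)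
  have isBigO {f : ℝ → ℂ} (hf : ∀ τ, τ₀ ≤ τ → ‖f τ‖ ≤ C / τ) :
      f =O[atTop] fun τ : ℝ => 1 / τ := by
    refine IsBigO.of_bound C ?_
    filter_upwards [eventually_ge_atTop τ₀] with τ hτ
    rw [Real.norm_of_nonneg (one_div_nonneg.2 (hτ₀.le.trans hτ)), mul_one_div]
    exact hf τ hτ
  have hmain := isBigO fun τ hτ => (hC τ hτ x hxε hR1 hR2).1
  exact ⟨differentiableAt_besselFactor k hx0,
    fun τ _ => differentiable_mittagLefflerVekua hα_pos k τ x, hmain,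
    fun j => isBigO fun τ hτ => (hC τ hτ x hxε hR1 hR2).2 j,
    tendsto_zero_of_isBigO_sub_log hmain⟩
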